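/- Throughout, $B(x,r)$ and $\overline B(x,r)$ are the open and closed Euclidean balls, and computability is that of Type-2 machines acting on names: a $\varrho^n$-name of $x\in\mathbb{R}^n$ is a sequence of rational vectors $q_j$ with $|x-q_j|<2^{-j}$; a $\nu$-name of $k\in\mathbb{N}$ is (a sequence starting with) $k$; a $\varrho_<$-name of $y\in\mathbb{R}\cup\{\pm\infty\}$ is a sequence of rationals with supremum $y$; a $\theta_<^n$-name of an open $U\subseteq\mathbb{R}^n$ is a list of open rational balls (possibly empty ones) with union $U$. A multi-valued function $F$ with nonempty values is $(\delta\rightrightarrows\gamma)$-computable if a machine turns every $\delta$-name of every argument $x$ into a $\gamma$-name of some element of $F(x)$, which may depend on the name of $x$; for single-valued functions one writes $(\delta\to\gamma)$-computable. A set $X\subseteq\mathbb{R}^n$ is r.e. open if it is the union of a computable sequence of open rational balls. A function $f:X\to\mathbb{R}^m$ is computable if it is $(\varrho^n\to\varrho^m)$-computable, and effectively open if it is open and $U\mapsto f[U]$ is $(\theta_<^n\to\theta_<^m)$-computable on the open sets $U\subseteq X$. Theorem. Let $X\subseteq\mathbb{R}^n$ be r.e. open. (a ii) Let $(x_j)_j$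 be a $(\nu\to\varrho^n)$-computable enumeration of a dense subset of $X$. A function $f:X\to\mathbb{R}^m$ is computable if and only if the sequence $(f(x_j))_j$ is $(\nu\to\varrho^m)$-computable and there is a $(\varrho^n\times\nu\rightrightarrows\nu)$-computable multi-valued function $\mathrm{moc}:X\times\mathbb{N}\rightrightarrows\mathbb{N}$ (with nonempty values) such that $f[B(x,2^{-\ell})\cap X]\subseteq B(f(x),2^{-k})$ for all $x\in X$, $k\in\mathbb{N}$, $\ell\in\mathrm{moc}(x,k)$. (b) Let $f:X\to\mathbb{R}^m$ be computable. Then the following are equivalent: $f$ is effectively open; (b i) the function $\mathrm{Moo}_f:X\times\mathbb{N}\to[0,\infty]$, $\mathrm{Moo}_f(x,k)=\sup\{s\ge 0:\overline B(f(x),s)\subseteq f[B(x,2^{-k})\cap X]\}$, is strictly positive and $(\varrho^n\times\nu\to\varrho_<)$-computable; (b ii) there is a $(\varrho^n\times\nu\rightrightarrows\nu)$-computable multi-valued function $\mathrm{moo}:X\times\mathbb{N}\rightrightarrows\mathbb{N}$ (with nonempty values) such that $B(f(x),2^{-\ell})\subseteq f[B(x,2^{-k})\cap X]$ for all $x\in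 X$, $k\in\mathbb{N}$, $\ell\in\mathrm{moo}(x,k)$. -/

import Mathlib

/-- Euclidean space `ℝᵈ` with the Euclidean norm. -/
abbrev Euc (d : ℕ) : Type := EuclideanSpace ℝ (Fin d)

/-! ## Numberings of the rationals, of rational vectors and of rational balls -/

/-- The standard numbering of `ℚ`: the triple `(a, b, c)` of naturals codes `(a - b) / (c + 1)`. -/
def ratCode (e : ℕ) : ℚ :=
  ((e.unpair.1 : ℚ) - (e.unpair.2.unpair.1 : ℚ)) / ((e.unpair.2.unpair.2 : ℚ) + 1)

/-- The standard numbering of `ℚᵈ`: `e` codes a list of naturals, whose first `d` entries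
(`0` where the list is too short) code the coordinates. -/
noncomputable def ratVec (d e : ℕ) : Euc d :=
  WithLp.toLp 2 fun i : Fin d =>
    ((ratCode ((Denumerable.ofNat (List ℕ) e).getD (i : ℕ) 0) : ℚ) : ℝ)

/-- The open rational ball with code `e = ⟨center, radius⟩`. A radius `≤ 0` codes the empty set, so
that the empty set can be listed, too. -/
noncomputable def ratBall (d e : ℕ) : Set (Euc d) :=
  Metric.ball (ratVec d e.unpair.1) ((ratCode e.unpair.2 : ℚ) : ℝ)

/-! ## Type-2 computability

Names are infinite sequences of natural numbers. -/

/-- The finite initial segment `p₀ … p_{k-1}` of the infinite sequence `p`. -/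
def initSeg (p : ℕ → ℕ) (k : ℕ) : List ℕ := (List.range k).map p

/-- A Type-2 machine (with one-way output), given by its computable action on finite words:
`out w` is the word that the machine has written once it has read `w` (and worked for `|w|`
rounds). What has been written is never revised: a longer input extends the output. -/
structure Type2Machine where
  out : List ℕ → List ℕ
  computable_out : Computable out
  mono_out : ∀ u v : List ℕ, u <+: v → out u <+: out v

/-- On the infinite input `p` the machine writes the infinite sequence `q`: each entry of `q`
is written after a finite part of `p` has been read. -/
def Type2Machine.Produces (M : Type2Machine) (p q : ℕ → ℕ) : Prop :=
  ∀ i : ℕ, ∃ k : ℕ, (M.out (initSeg p k))[i]? = some (q i)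

/-- A naming system for the elements of `A`: `δ p x` says that `p` is a `δ`-name of `x`. -/
abbrev Naming (A : Type) : Type := (ℕ → ℕ) → A → Prop

/-- The naming system for a subset. -/
def Naming.restrict {A : Type} (δ : Naming A) (S : Set A) : Naming S :=
  fun p x => δ p (x : A)

/-- The product: a name of `(x, y)` is a name of `x` and a name of `y`, merged entry by entry. -/
def Naming.prod {A B : Type} (δ : Naming A) (γ : Naming B) : Naming (A × B) :=
  fun p z => δ (fun i => (p i).unpair.1) z.1 ∧ γ (fun i => (p i).unpair.2) z.2

/-- `(δ ⇉ γ)`-computability of a multi-valued `F` (whose domain is the set of `x` with `F x ≠ ∅`):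
some machine turns every `δ`-name of every `x` in the domain into a `γ`-name of some element
of `F x`; which element may depend on the name of `x`. -/
def IsComputableMulti {A B : Type} (δ : Naming A) (γ : Naming B) (F : A → Set B) : Prop :=
  ∃ M : Type2Machine, ∀ (p : ℕ → ℕ) (x : A), δ p x → (F x).Nonempty →
    ∃ (q : ℕ → ℕ) (y : B), M.Produces p q ∧ γ q y ∧ y ∈ F x

/-- `(δ → γ)`-computability of a single-valued function. -/
def IsComputableMap {A B : Type} (δ : Naming A) (γ : Naming B) (f : A → B) : Prop :=
  IsComputableMulti δ γ (fun x => {f x})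

/-! ## The naming systems for `ℕ`, `ℝᵈ`, lower reals and open sets -/

/-- `ν`: a name of `k` starts with `k`. -/
def natNaming : Naming ℕ := fun p k => p 0 = k

/-- `ϱᵈ`: a name of `x ∈ ℝᵈ` is a sequence of rational vectors `q_j` with `|x - q_j| < 2⁻ʲ`. -/
def cauchyNaming (d : ℕ) : Naming (Euc d) :=
  fun p x => ∀ j : ℕ, ‖x - ratVec d (p j)‖ < (2 : ℝ)⁻¹ ^ j

/-- `ϱ_<`, on the extended reals: a name of `y` is a sequence of rationals with supremum `y`. -/
def lowerNaming : Naming EReal :=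
  fun p y => IsLUB (Set.range fun j : ℕ => (((ratCode (p j) : ℚ) : ℝ) : EReal)) y

/-- `θ_<ᵈ`: a name of an open set is a list of open rational balls that exhausts it. -/
def openNaming (d : ℕ) : Naming (Set (Euc d)) :=
  fun p U => U = ⋃ j : ℕ, ratBall d (p j)

/-- r.e. open: the union of a computable sequence of open rational balls. -/
def IsREOpen {d : ℕ} (X : Set (Euc d)) : Prop :=
  ∃ p : ℕ → ℕ, Computable p ∧ openNaming d p X

/-! ## Computable and effectively open functions, moduli -/

/-- The image `f[U ∩ X]` of a set `U ⊆ ℝⁿ` under `f : X → ℝᵐ`. -/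
def imageOn {n m : ℕ} {X : Set (Euc n)} (f : X → Euc m) (U : Set (Euc n)) : Set (Euc m) :=
  f '' ((Subtype.val : X → Euc n) ⁻¹' U)

/-- Computability of `f : X → ℝᵐ`. -/
def IsComputableFun {n m : ℕ} {X : Set (Euc n)} (f : X → Euc m) : Prop :=
  IsComputableMap ((cauchyNaming n).restrict X) (cauchyNaming m) f

/-- Effective openness of `f : X → ℝᵐ` (for open `X`): `f` is open and the map `U ↦ f[U]` on the
open subsets `U` of `X` is `(θ_<ⁿ → θ_<ᵐ)`-computable. -/
def IsEffectivelyOpen {n m : ℕ} {X : Set (Euc n)} (f : X → Euc m) : Prop :=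
  IsOpenMap f ∧
    IsComputableMap ((openNaming n).restrict {U : Set (Euc n) | IsOpen U ∧ U ⊆ X}) (openNaming m)
      (fun U => imageOn f (U : Set (Euc n)))

/-- The modulus of openness
`Moo_f (x, k) = sup {s ≥ 0 : closedBall (f x) s ⊆ f[B(x, 2⁻ᵏ) ∩ X]}`. The supremum is taken in the
extended reals; it is `∞` if `f[B(x, 2⁻ᵏ) ∩ X]` is all of `ℝᵐ`. -/
noncomputable def Moo {n m : ℕ} {X : Set (Euc n)} (f : X → Euc m) (z : X × ℕ) : EReal :=
  sSup ((fun s : ℝ => (s : EReal)) ''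
    {s : ℝ | 0 ≤ s ∧
      Metric.closedBall (f z.1) s ⊆
        imageOn f (Metric.ball (z.1 : Euc n) ((2 : ℝ)⁻¹ ^ z.2))})

/-- `moc : X × ℕ ⇉ ℕ` is a multi-valued modulus of continuity of `f`: it is total and
`f[B(x, 2⁻ˡ) ∩ X] ⊆ B(f x, 2⁻ᵏ)` for all `l ∈ moc (x, k)`. -/
def IsModulusOfContinuity {n m : ℕ} {X : Set (Euc n)} (f : X → Euc m)
    (moc : X × ℕ → Set ℕ) : Prop :=
  ∀ (x : X) (k : ℕ), (moc (x, k)).Nonempty ∧ ∀ l ∈ moc (x, k),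
    imageOn f (Metric.ball (x : Euc n) ((2 : ℝ)⁻¹ ^ l)) ⊆ Metric.ball (f x) ((2 : ℝ)⁻¹ ^ k)

/-- `moo : X × ℕ ⇉ ℕ` is a multi-valued modulus of openness of `f`: it is total and
`B(f x, 2⁻ˡ) ⊆ f[B(x, 2⁻ᵏ) ∩ X]` for all `l ∈ moo (x, k)`. -/
def IsModulusOfOpenness {n m : ℕ} {X : Set (Euc n)} (f : X → Euc m)
    (moo : X × ℕ → Set ℕ) : Prop :=
  ∀ (x : X) (k : ℕ), (moo (x, k)).Nonempty ∧ ∀ l ∈ moo (x, k),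
    Metric.ball (f x) ((2 : ℝ)⁻¹ ^ l) ⊆ imageOn f (Metric.ball (x : Euc n) ((2 : ℝ)⁻¹ ^ k))

/-- `(ϱⁿ × ν ⇉ ν)`-computability of a multi-valued `X × ℕ ⇉ ℕ`. -/
def IsComputableModulus {n : ℕ} {X : Set (Euc n)} (μ : X × ℕ → Set ℕ) : Prop :=
  IsComputableMulti (((cauchyNaming n).restrict X).prod natNaming) natNaming μ

/-! A finite computation reads only finitely many letters of a name. Since the inequalities in a
name are strict, these letters also begin a name of every point in a small rational ball around the
given point, so what a machine writes about one point is true on a whole ball. Conversely, an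
enumeration of facts about rational balls yields a machine: it searches for a ball that the input is
seen to lie in and for a fact about that ball. Thus computability becomes the existence of a
semidecidable relation between codes of balls that is sound (related codes give a fact valid at all
points of the ball) and complete (the facts are found for all sufficiently small balls around a
point). The translations are `isComputableFun_iff`, `isComputableMap_nat_iff`,
`exists_isComputableModulus_iff`, `isComputableMap_lowerNaming_iff` and `isEffectivelyOpen_iff`. The
filter `ballsAt` expresses "all sufficiently small balls around `x`", so that finitely many such
conditions can be combined.

After that the theorem is geometry of balls. For (a ii), a computable `f` maps some ball around `x`
into a small ball, and the depth of `x` in the former is a modulus; conversely, the modulus says how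
close `x_j` must be to `x` for `f(x_j)` to approximate `f(x)`. For (b ii), the depth of `f(x)` in a
ball contained in the image of a ball near `x` is a modulus of openness; conversely, a modulus at
centers of small balls yields enough balls inside the image.

For (b i), a positive lower bound for `Moo` gives a modulus of openness. Conversely, `closedBall (f
x) s` is compact, so its inclusion in an enumerated union of balls can be verified by a sufficiently
fine finite grid (`GridCovers.subset`, `exists_gridCovers`). -/

open Filter Topology

-- Automation for primitive recursive functions

attribute [fun_prop] Primrec Primrec.id Primrec.const Primrec.comp

namespace Primrec

variable {α β γ : Type} [Primcodable α] [Primcodable β] [Primcodable γ]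

@[fun_prop]
theorem fst_apply {f : α → β × γ} (hf : Primrec f) : Primrec fun a => (f a).1 :=
  Primrec.fst.comp hf

@[fun_prop]
theorem snd_apply {f : α → β × γ} (hf : Primrec f) : Primrec fun a => (f a).2 :=
  Primrec.snd.comp hf

@[fun_prop]
theorem prodMk {f : α → β} {g : α → γ} (hf : Primrec f) (hg : Primrec g) :
    Primrec fun a => (f a, g a) :=
  hf.pair hg

@[fun_prop]
theorem unpair_apply {f : α → ℕ} (hf : Primrec f) : Primrec fun a => (f a).unpair :=
  Primrec.unpair.comp hf

@[fun_prop]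
theorem natPair_apply {f g : α → ℕ} (hf : Primrec f) (hg : Primrec g) :
    Primrec fun a => Nat.pair (f a) (g a) :=
  Primrec₂.natPair.comp hf hg

@[fun_prop]
theorem natAdd_apply {f g : α → ℕ} (hf : Primrec f) (hg : Primrec g) :
    Primrec fun a => f a + g a :=
  Primrec.nat_add.comp hf hg

@[fun_prop]
theorem natSub_apply {f g : α → ℕ} (hf : Primrec f) (hg : Primrec g) :
    Primrec fun a => f a - g a :=
  Primrec.nat_sub.comp hf hg

@[fun_prop]
theorem natMul_apply {f g : α → ℕ} (hf : Primrec f) (hg : Primrec g) :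
    Primrec fun a => f a * g a :=
  Primrec.nat_mul.comp hf hg

@[fun_prop]
theorem listLength_apply {f : α → List β} (hf : Primrec f) : Primrec fun a => (f a).length :=
  Primrec.list_length.comp hf

@[fun_prop]
theorem listTake_apply {f : α → List β} {g : α → ℕ} (hf : Primrec f) (hg : Primrec g) :
    Primrec fun a => (f a).take (g a) :=
  Primrec.list_take.comp hg hf

@[fun_prop]
theorem listCons_apply {f : α → β} {g : α → List β} (hf : Primrec f) (hg : Primrec g) :
    Primrec fun a => f a :: g a :=
  Primrec.list_cons.comp hf hg

@[fun_prop]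
theorem listGetD_apply {f : α → List β} {g : α → ℕ} {d : β} (hf : Primrec f) (hg : Primrec g) :
    Primrec fun a => (f a).getD (g a) d :=
  (Primrec.list_getD d).comp hf hg

@[fun_prop]
theorem listGetElem?_apply {f : α → List β} {g : α → ℕ} (hf : Primrec f) (hg : Primrec g) :
    Primrec fun a => (f a)[g a]? :=
  Primrec.list_getElem?.comp hf hg

@[fun_prop]
theorem ofNat_apply {δ : Type} [Denumerable δ] {f : α → ℕ} (hf : Primrec f) :
    Primrec fun a => Denumerable.ofNat δ (f a) :=
  (Primrec.ofNat δ).comp hf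

end Primrec

/-! ### Closure properties of semidecidable predicates -/

/-- A semidecidable predicate: the projection of a primitive recursive one. -/
def SemiDec {α : Type} [Primcodable α] (P : α → Prop) : Prop :=
  ∃ R : α × ℕ → Prop, PrimrecPred R ∧ ∀ a, P a ↔ ∃ s, R (a, s)

namespace SemiDec

variable {α β γ : Type} [Primcodable α] [Primcodable β] [Primcodable γ]

theorem of_primrecPred {P : α → Prop} (h : PrimrecPred P) : SemiDec P :=
  ⟨fun z => P z.1, h.comp Primrec.fst, fun _ => by simp⟩

theorem of_iff {P Q : α → Prop} (h : SemiDec P) (H : ∀ a, Q a ↔ P a) : SemiDec Q := by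
  rwa [funext fun a => propext (H a)]

theorem comp {P : β → Prop} (h : SemiDec P) {f : α → β} (hf : Primrec f) :
    SemiDec fun a => P (f a) := by
  obtain ⟨R, hR, H⟩ := h
  exact ⟨fun z => R (f z.1, z.2), hR.comp (f := fun z : α × ℕ => (f z.1, z.2)) (by fun_prop),
    fun a => H (f a)⟩

theorem comp₂ {P : β → γ → Prop} (h : SemiDec fun z : β × γ => P z.1 z.2) {f : α → β} {g : α → γ}
    (hf : Primrec f) (hg : Primrec g) : SemiDec fun a => P (f a) (g a) :=
  h.comp (f := fun a => (f a, g a)) (hf.pair hg)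

theorem comp₃ {δ : Type} [Primcodable δ] {P : β → γ → δ → Prop}
    (h : SemiDec fun z : β × γ × δ => P z.1 z.2.1 z.2.2) {f : α → β} {g : α → γ} {k : α → δ}
    (hf : Primrec f) (hg : Primrec g) (hk : Primrec k) : SemiDec fun a => P (f a) (g a) (k a) :=
  h.comp (f := fun a => (f a, g a, k a)) (by fun_prop)

theorem and {P Q : α → Prop} (hP : SemiDec P) (hQ : SemiDec Q) : SemiDec fun a => P a ∧ Q a := by
  obtain ⟨R, hR, H⟩ := hP
  obtain ⟨S, hS, H'⟩ := hQ
  refine ⟨fun z => R (z.1, z.2.unpair.1) ∧ S (z.1, z.2.unpair.2),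
    (hR.comp (f := fun z : α × ℕ => (z.1, z.2.unpair.1)) (by fun_prop)).and
      (hS.comp (f := fun z : α × ℕ => (z.1, z.2.unpair.2)) (by fun_prop)), fun a => ?_⟩
  constructor
  · rintro ⟨h, h'⟩
    obtain ⟨s, hs⟩ := (H a).1 h
    obtain ⟨t, ht⟩ := (H' a).1 h'
    exact ⟨Nat.pair s t, by simpa using ⟨hs, ht⟩⟩
  · rintro ⟨s, hs, ht⟩
    exact ⟨(H a).2 ⟨_, hs⟩, (H' a).2 ⟨_, ht⟩⟩

theorem or {P Q : α → Prop} (hP : SemiDec P) (hQ : SemiDec Q) : SemiDec fun a => P a ∨ Q a := by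
  obtain ⟨R, hR, H⟩ := hP
  obtain ⟨S, hS, H'⟩ := hQ
  exact ⟨fun z => R z ∨ S z, hR.or hS, fun a => ((H a).or (H' a)).trans exists_or.symm⟩

theorem ex {P : α → ℕ → Prop} (h : SemiDec fun z : α × ℕ => P z.1 z.2) :
    SemiDec fun a => ∃ n, P a n := by
  obtain ⟨R, hR, H⟩ := h
  refine ⟨fun z => R ((z.1, z.2.unpair.1), z.2.unpair.2),
    hR.comp (f := fun z : α × ℕ => ((z.1, z.2.unpair.1), z.2.unpair.2)) (by fun_prop),
    fun a => ?_⟩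
  constructor
  · rintro ⟨n, hn⟩
    obtain ⟨s, hs⟩ := (H (a, n)).1 hn
    exact ⟨Nat.pair n s, by simpa using hs⟩
  · rintro ⟨s, hs⟩
    exact ⟨_, (H (a, _)).2 ⟨_, hs⟩⟩

theorem ex_list {P : α → List ℕ → Prop} (h : SemiDec fun z : α × List ℕ => P z.1 z.2) :
    SemiDec fun a => ∃ w, P a w := by
  refine of_iff (SemiDec.ex (P := fun a n => P a (Denumerable.ofNat (List ℕ) n))
    (h.comp₂ (by fun_prop) (by fun_prop))) fun a => ⟨fun ⟨w, hw⟩ => ?_, fun ⟨n, hn⟩ => ⟨_, hn⟩⟩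
  exact ⟨Encodable.encode w, by simpa using hw⟩

/-- Finitely many witnesses have a common bound. That bound is the single existential witness, and
only bounded quantifiers remain behind it. -/
theorem forall_lt {P : α → ℕ → Prop} (h : SemiDec fun z : α × ℕ => P z.1 z.2) {f : α → ℕ}
    (hf : Primrec f) : SemiDec fun a => ∀ i < f a, P a i := by
  obtain ⟨R, hR, H⟩ := h
  have h1 : PrimrecRel fun (s : ℕ) (z : α × ℕ) => R (z, s) :=
    hR.comp (f := fun z : ℕ × α × ℕ => (z.2, z.1)) (by fun_prop)
  have h2 : PrimrecRel fun (i : ℕ) (z : α × ℕ) => ∃ s ∈ List.range z.2, R ((z.1, i), s) :=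
    (h1.exists_mem_list.comp (f := fun z : ℕ × α × ℕ => List.range z.2.2)
      (g := fun z : ℕ × α × ℕ => (z.2.1, z.1)) (Primrec.list_range.comp (by fun_prop))
      (by fun_prop))
  have h3 : PrimrecPred fun z : α × ℕ =>
      ∀ i ∈ List.range (f z.1), ∃ s ∈ List.range z.2, R ((z.1, i), s) :=
    h2.forall_mem_list.comp (f := fun z : α × ℕ => List.range (f z.1)) (g := fun z => z)
      (Primrec.list_range.comp (by fun_prop)) (by fun_prop)
  refine ⟨_, h3, fun a => ?_⟩
  simp only [List.mem_range]
  constructor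
  · intro ha
    choose! s hs using fun i hi => (H (a, i)).1 (ha i hi)
    refine ⟨(Finset.range (f a)).sup s + 1, fun i hi => ⟨s i, Nat.lt_succ_of_le ?_, hs i hi⟩⟩
    exact Finset.le_sup (f := s) (Finset.mem_range.2 hi)
  · rintro ⟨S, hS⟩ i hi
    obtain ⟨s, -, hs⟩ := hS i hi
    exact (H (a, i)).2 ⟨s, hs⟩

/-- The graph of a computable function is semidecidable. -/
theorem graph {f : α → β} (hf : Computable f) : SemiDec fun z : α × β => f z.1 = z.2 := by
  obtain ⟨c, hc⟩ := Nat.Partrec.Code.exists_code.1 hf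
  -- Running a program with bounded resources is primitive recursive; the bound is the witness.
  have key : ∀ a b, f a = b ↔
      ∃ s, Nat.Partrec.Code.evaln s c (Encodable.encode a) = some (Encodable.encode b) := by
    intro a b
    have h1 := @Nat.Partrec.Code.evaln_complete c (Encodable.encode a) (Encodable.encode b)
    simp only [Option.mem_def] at h1
    rw [← h1, hc]
    simp [eq_comm]
  refine ⟨fun z => Nat.Partrec.Code.evaln z.2 c (Encodable.encode z.1.1)
    = some (Encodable.encode z.1.2), ?_, fun z => key z.1 z.2⟩
  refine Primrec.eq.comp (Nat.Partrec.Code.primrec_evaln.comp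
    (g := fun z : (α × β) × ℕ => ((z.2, c), Encodable.encode z.1.1)) ?_) ?_
  · exact (Primrec.snd.pair (Primrec.const c)).pair (Primrec.encode.comp (by fun_prop))
  · exact Primrec.option_some.comp (Primrec.encode.comp (by fun_prop))

/-- All words of length `d` over the alphabet `{0, …, K - 1}` satisfy `P`. -/
theorem forall_words (d : ℕ) : ∀ {α : Type} [Primcodable α] {P : α → List ℕ → Prop},
    (SemiDec fun z : α × List ℕ => P z.1 z.2) → ∀ {K : α → ℕ}, Primrec K →
      SemiDec fun a => ∀ v : List ℕ, v.length = d → (∀ i ∈ v, i < K a) → P a v := by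
  induction d with
  | zero =>
    intro α _ P h K hK
    refine of_iff (h.comp₂ (f := fun a => a) (g := fun _ => []) (by fun_prop) (by fun_prop))
      fun a => ⟨fun H => H [] rfl (by simp), fun H v hv _ => ?_⟩
    rwa [List.length_eq_zero_iff.1 hv]
  | succ d ih =>
    intro α _ P h K hK
    refine of_iff (forall_lt (P := fun a i => ∀ v : List ℕ, v.length = d → (∀ i ∈ v, i < K a) →
      P a (i :: v)) (ih (α := α × ℕ) (P := fun z v => P z.1 (z.2 :: v))
        (K := fun z => K z.1) (h.comp₂ (by fun_prop) (by fun_prop)) (by fun_prop)) hK)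
      fun a => ⟨fun H i hi v hv hv' => H _ (by simp [hv]) (by simpa using ⟨hi, hv'⟩), ?_⟩
    intro H v hv hv'
    obtain ⟨i, v, rfl⟩ := List.exists_cons_of_length_eq_add_one hv
    exact H i (hv' i (by simp)) v (by simpa using hv) fun j hj => hv' j (by simp [hj])

end SemiDec

/-! ## Type-2 machines -/

theorem length_initSeg (p : ℕ → ℕ) (k : ℕ) : (initSeg p k).length = k := by simp [initSeg]

theorem getD_initSeg {p : ℕ → ℕ} {k i d : ℕ} (h : i < k) : (initSeg p k).getD i d = p i := by
  simp [initSeg, h]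

theorem take_initSeg (p : ℕ → ℕ) {k l : ℕ} (h : k ≤ l) : (initSeg p l).take k = initSeg p k := by
  simp [initSeg, ← List.map_take, List.take_range, min_eq_left h]

theorem initSeg_prefix (p : ℕ → ℕ) {k l : ℕ} (h : k ≤ l) : initSeg p k <+: initSeg p l := by
  rw [← take_initSeg p h]
  exact List.take_prefix _ _

theorem initSeg_map (p g : ℕ → ℕ) (k : ℕ) : (initSeg p k).map g = initSeg (fun i => g (p i)) k := by
  simp [initSeg, Function.comp_def]

/-- The infinite sequence that starts with `w` and goes on as `g`. -/
def extendWord (w : List ℕ) (g : ℕ → ℕ) : ℕ → ℕ := fun i => (w[i]?).getD (g i)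

theorem initSeg_extendWord (w : List ℕ) (g : ℕ → ℕ) : initSeg (extendWord w g) w.length = w := by
  refine List.ext_getElem (by simp [initSeg]) fun i h1 h2 => ?_
  simp [initSeg, extendWord, h2]

theorem extendWord_of_lt (w : List ℕ) (g : ℕ → ℕ) {i : ℕ} (h : i < w.length) (d : ℕ) :
    extendWord w g i = w.getD i d := by
  simp [extendWord, h]

theorem extendWord_of_le (w : List ℕ) (g : ℕ → ℕ) {i : ℕ} (h : w.length ≤ i) :
    extendWord w g i = g i := by
  simp [extendWord, h]

theorem List.IsPrefix.getElem?_eq_some_of {u v : List ℕ} (h : u <+: v) {i a : ℕ}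
    (ha : u[i]? = some a) : v[i]? = some a := by
  obtain ⟨t, rfl⟩ := h
  rw [List.getElem?_append_left (List.getElem?_eq_some_iff.1 ha).1, ha]

namespace Type2Machine

/-- Whatever has been written after any finite input is final: the outputs on two initial segments
of `p` are prefixes of the output on the longer one. -/
theorem Produces.eq {M : Type2Machine} {p q : ℕ → ℕ} (h : M.Produces p q) {k i a : ℕ}
    (ha : (M.out (initSeg p k))[i]? = some a) : a = q i := by
  obtain ⟨l, hl⟩ := h i
  have h1 := (M.mono_out _ _ (initSeg_prefix p (le_max_left k l))).getElem?_eq_some_of ha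
  have h2 := (M.mono_out _ _ (initSeg_prefix p (le_max_right k l))).getElem?_eq_some_of hl
  simpa using h1.symm.trans h2

/-- `M.out` is merely computable, so its value is guessed as a word `v` and checked through the
graph. -/
theorem semiDec_out (M : Type2Machine) :
    SemiDec fun z : List ℕ × ℕ × ℕ => (M.out z.1)[z.2.1]? = some z.2.2 := by
  refine SemiDec.of_iff (SemiDec.ex_list (P := fun (z : List ℕ × ℕ × ℕ) v =>
    M.out z.1 = v ∧ v[z.2.1]? = some z.2.2) (SemiDec.and
      ((SemiDec.graph M.computable_out).comp₂ (P := fun a b => M.out a = b) (by fun_prop)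
        (by fun_prop)) (SemiDec.of_primrecPred ?_))) fun z => by simp
  exact Primrec.eq.comp (by fun_prop) (Primrec.option_some.comp (by fun_prop))

end Type2Machine

/-! ### Machines obtained from unbounded search -/

theorem findIdx_range_le (T : ℕ → Bool) (N : ℕ) : (List.range N).findIdx T ≤ N := by
  simpa using List.findIdx_le_length (p := T) (xs := List.range N)

theorem findIdx_range_spec {T : ℕ → Bool} {N : ℕ} (h : (List.range N).findIdx T < N) :
    T ((List.range N).findIdx T) = true := by
  have := List.findIdx_getElem (p := T) (xs := List.range N) (w := by simpa using h)
  simpa using this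

theorem findIdx_range_eq {T : ℕ → Bool} {N t : ℕ} (h : t < N) (ht : T t = true)
    (H : ∀ y < t, T y = false) : (List.range N).findIdx T = t := by
  rw [List.findIdx_eq (by simpa using h)]
  simpa using ⟨ht, H⟩

theorem findIdx_range_min {T : ℕ → Bool} {N y : ℕ} (h : y < (List.range N).findIdx T) :
    T y = false := by
  have := List.not_of_lt_findIdx (p := T) (xs := List.range N) h
  simpa using this

namespace Type2Machine

open Classical in
/-- The first `t = ⟨k, ⟨o, s⟩⟩` up to the length of `w` such that `R` accepts `o` as `i`-th output at
stage `s` on the first `k` letters of `w` (the length plus one if there is none). -/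
noncomputable def searchStage (R : (List ℕ × ℕ × ℕ) × ℕ → Prop) (w : List ℕ) (i : ℕ) : ℕ :=
  (List.range (w.length + 1)).findIdx fun t =>
    decide (R ((w.take t.unpair.1, i, t.unpair.2.unpair.1), t.unpair.2.unpair.2))

/-- The number of successful initial searches. -/
noncomputable def searchLength (R : (List ℕ × ℕ × ℕ) × ℕ → Prop) (w : List ℕ) : ℕ :=
  (List.range w.length).findIdx fun i => decide (searchStage R w i = w.length + 1)

/-- The word of the results of the successful initial searches. -/
noncomputable def searchOut (R : (List ℕ × ℕ × ℕ) × ℕ → Prop) (w : List ℕ) : List ℕ :=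
  (List.range (searchLength R w)).map fun i => (searchStage R w i).unpair.2.unpair.1

variable {R : (List ℕ × ℕ × ℕ) × ℕ → Prop}

theorem primrec_searchStage (hR : PrimrecPred R) :
    Primrec fun z : List ℕ × ℕ => searchStage R z.1 z.2 := by
  classical
  refine Primrec.list_findIdx (Primrec.list_range.comp (by fun_prop)) ?_
  exact (hR.comp (f := fun z : (List ℕ × ℕ) × ℕ => ((z.1.1.take z.2.unpair.1, z.1.2,
    z.2.unpair.2.unpair.1), z.2.unpair.2.unpair.2)) (by fun_prop)).decide

theorem primrec_searchOut (hR : PrimrecPred R) : Primrec (searchOut R) := by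
  have h := primrec_searchStage hR
  have h1 : Primrec (searchLength R) := by
    refine Primrec.list_findIdx (Primrec.list_range.comp (by fun_prop)) ?_
    exact (Primrec.eq.comp (f := fun z : List ℕ × ℕ => searchStage R z.1 z.2)
      (g := fun z => z.1.length + 1) h (by fun_prop)).decide
  refine Primrec.list_map (Primrec.list_range.comp h1) ?_
  change Primrec fun z : List ℕ × ℕ => (searchStage R z.1 z.2).unpair.2.unpair.1
  fun_prop

/-- A successful search stops at some `t ≤ u.length`. All candidates up to `t` inspect at most `t`
letters, hence only letters of `u`, and a longer word cannot change the result. -/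
theorem searchStage_eq_of_prefix {u v : List ℕ} (h : u <+: v) {i : ℕ}
    (hi : searchStage R u i < u.length + 1) : searchStage R v i = searchStage R u i := by
  have hl := h.length_le
  have key : ∀ t ≤ u.length, v.take t.unpair.1 = u.take t.unpair.1 := by
    intro t ht
    obtain ⟨s, rfl⟩ := h
    rw [List.take_append_of_le_length ((Nat.unpair_left_le t).trans ht)]
  refine findIdx_range_eq (by lia) ?_ fun y hy => ?_
  · rw [key _ (by lia)]
    exact findIdx_range_spec hi
  · rw [key _ (by lia)]
    exact findIdx_range_min hy

theorem searchStage_lt {w : List ℕ} {i : ℕ} (hi : i < searchLength R w) :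
    searchStage R w i < w.length + 1 := by
  have h1 : searchStage R w i ≠ w.length + 1 := by simpa using findIdx_range_min hi
  have h2 : searchStage R w i ≤ w.length + 1 := findIdx_range_le _ _
  lia

theorem lt_searchLength {w : List ℕ} {n : ℕ} (hn : n ≤ w.length)
    (h : ∀ i < n, searchStage R w i < w.length + 1) : n ≤ searchLength R w := by
  by_contra! hlt
  have h1 : searchStage R w (searchLength R w) = w.length + 1 :=
    of_decide_eq_true (findIdx_range_spec (hlt.trans_le hn))
  have := h _ hlt
  lia

theorem searchOut_prefix {u v : List ℕ} (h : u <+: v) : searchOut R u <+: searchOut R v := by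
  have hs : ∀ i < searchLength R u, searchStage R v i = searchStage R u i := fun i hi =>
    searchStage_eq_of_prefix h (searchStage_lt hi)
  have hl := h.length_le
  have hn : searchLength R u ≤ searchLength R v := by
    refine lt_searchLength ((findIdx_range_le _ _).trans hl) fun i hi => ?_
    have := searchStage_lt hi
    rw [hs i hi]
    lia
  have : searchOut R u = (searchOut R v).take (searchLength R u) := by
    rw [searchOut, searchOut, ← List.map_take, List.take_range, min_eq_left hn]
    exact List.map_congr_left fun i hi => by rw [hs i (List.mem_range.1 hi)]
  rw [this]
  exact List.take_prefix _ _

/-- A machine whose `i`-th output may be any `o` such that `R (w, i, o)` for some initial segment `w`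
of the input. -/
theorem exists_of_semiDec {R : List ℕ → ℕ → ℕ → Prop}
    (hR : SemiDec fun z : List ℕ × ℕ × ℕ => R z.1 z.2.1 z.2.2) :
    ∃ M : Type2Machine, ∀ p : ℕ → ℕ, (∀ i, ∃ k o, R (initSeg p k) i o) →
      ∃ q, M.Produces p q ∧ ∀ i, ∃ k, R (initSeg p k) i (q i) := by
  classical
  obtain ⟨S, hS, H⟩ := hR
  refine ⟨⟨searchOut S, (primrec_searchOut hS).to_comp, fun u v => searchOut_prefix⟩,
    fun p hp => ?_⟩
  have ex : ∀ i, ∃ t : ℕ,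
      S ((initSeg p t.unpair.1, i, t.unpair.2.unpair.1), t.unpair.2.unpair.2) := by
    intro i
    obtain ⟨k, o, h⟩ := hp i
    obtain ⟨s, hs⟩ := (H (initSeg p k, i, o)).1 h
    exact ⟨Nat.pair k (Nat.pair o s), by simpa only [Nat.unpair_pair] using hs⟩
  have hst : ∀ K i, Nat.find (ex i) ≤ K → searchStage S (initSeg p K) i = Nat.find (ex i) := by
    intro K i hK
    have htake : ∀ t ≤ K, (initSeg p K).take t.unpair.1 = initSeg p t.unpair.1 := fun t ht =>
      take_initSeg p ((Nat.unpair_left_le t).trans ht)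
    refine findIdx_range_eq (by rw [length_initSeg]; lia) ?_ fun y hy => ?_
    · rw [htake _ hK]
      simpa using Nat.find_spec (ex i)
    · rw [htake _ (by lia)]
      simpa using Nat.find_min (ex i) hy
  refine ⟨fun i => (Nat.find (ex i)).unpair.2.unpair.1, fun i => ?_,
    fun i => ⟨_, (H (_, _, _)).2 ⟨_, Nat.find_spec (ex i)⟩⟩⟩
  -- Output stops at the first unfinished search, so all searches up to `i` must have ended. The
  -- summand `i + 1` is needed because a word `w` allows at most `w.length` outputs.
  let K := (Finset.range (i + 1)).sup (fun j => Nat.find (ex j)) + (i + 1)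
  have hK : ∀ j < i + 1, Nat.find (ex j) ≤ K := fun j hj =>
    (Finset.le_sup (f := fun j => Nat.find (ex j)) (Finset.mem_range.2 hj)).trans
      (Nat.le_add_right _ _)
  have hlen : i + 1 ≤ searchLength S (initSeg p K) := by
    refine lt_searchLength (by rw [length_initSeg]; lia) fun j hj => ?_
    rw [hst K j (hK j hj), length_initSeg]
    have := hK j hj
    lia
  refine ⟨K, ?_⟩
  simp only [searchOut]
  rw [List.getElem?_map, List.getElem?_range (by lia), Option.map_some, hst K i (hK i (by lia))]

/-- A machine that enumerates all `o` such that `E (w, o)` for some initial segment `w` of the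
input. The number `0` is used as filler. -/
theorem exists_enumerating {E : List ℕ → ℕ → Prop}
    (hE : SemiDec fun z : List ℕ × ℕ => E z.1 z.2) :
    ∃ M : Type2Machine, ∀ p : ℕ → ℕ, ∃ q, M.Produces p q ∧
      (∀ i, q i = 0 ∨ ∃ k, E (initSeg p k) (q i)) ∧
      ∀ k o, E (initSeg p k) o → ∃ i, q i = o := by
  obtain ⟨S, hS, H⟩ := hE
  -- The index `i` codes a length, a candidate and a stage. Fixing the length of the word makes the
  -- negated test unambiguous: only one initial segment of the input is consulted.
  have hR : SemiDec fun z : List ℕ × ℕ × ℕ => z.1.length = z.2.1.unpair.1 ∧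
      ((S ((z.1, z.2.1.unpair.2.unpair.1), z.2.1.unpair.2.unpair.2) ∧
        z.2.2 = z.2.1.unpair.2.unpair.1) ∨
      (¬ S ((z.1, z.2.1.unpair.2.unpair.1), z.2.1.unpair.2.unpair.2) ∧ z.2.2 = 0)) := by
    have h1 := hS.comp (f := fun z : List ℕ × ℕ × ℕ =>
      ((z.1, z.2.1.unpair.2.unpair.1), z.2.1.unpair.2.unpair.2)) (by fun_prop)
    exact SemiDec.of_primrecPred ((Primrec.eq.comp (by fun_prop) (by fun_prop)).and
      ((h1.and (Primrec.eq.comp (by fun_prop) (by fun_prop))).or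
        (h1.not.and (Primrec.eq.comp (by fun_prop) (by fun_prop)))))
  obtain ⟨M, hM⟩ := exists_of_semiDec (R := fun w i o => w.length = i.unpair.1 ∧
      ((S ((w, i.unpair.2.unpair.1), i.unpair.2.unpair.2) ∧ o = i.unpair.2.unpair.1) ∨
      (¬ S ((w, i.unpair.2.unpair.1), i.unpair.2.unpair.2) ∧ o = 0))) hR
  refine ⟨M, fun p => ?_⟩
  obtain ⟨q, hq, hq'⟩ := hM p fun i => by
    refine ⟨i.unpair.1, ?_⟩
    by_cases h : S ((initSeg p i.unpair.1, i.unpair.2.unpair.1), i.unpair.2.unpair.2)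
    · exact ⟨_, length_initSeg _ _, Or.inl ⟨h, rfl⟩⟩
    · exact ⟨_, length_initSeg _ _, Or.inr ⟨h, rfl⟩⟩
  refine ⟨q, hq, fun i => ?_, fun k o h => ?_⟩
  · obtain ⟨k, -, ⟨hk, hk'⟩ | h⟩ := hq' i
    · exact Or.inr ⟨k, (H (_, _)).2 ⟨_, by rwa [hk']⟩⟩
    · exact Or.inl h.2
  · obtain ⟨s, hs⟩ := (H (_, _)).1 h
    refine ⟨Nat.pair k (Nat.pair o s), ?_⟩
    obtain ⟨l, hl, h⟩ := hq' (Nat.pair k (Nat.pair o s))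
    rw [length_initSeg] at hl
    subst hl
    simp only [Nat.unpair_pair] at h
    obtain h | h := h
    · exact h.2
    · exact absurd hs h.1

end Type2Machine

/-! ## Arithmetic of codes of rationals -/

theorem ratCode_pair (a b c : ℕ) :
    ratCode (Nat.pair a (Nat.pair b c)) = ((a : ℚ) - b) / ((c : ℚ) + 1) := by
  simp [ratCode]

theorem ratCode_zero : ratCode 0 = 0 := by
  simp [ratCode]

theorem ratCode_surjective : Function.Surjective ratCode := by
  intro q
  refine ⟨Nat.pair q.num.toNat (Nat.pair (-q.num).toNat (q.den - 1)), ?_⟩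
  have h1 : ((q.num.toNat : ℤ) - ((-q.num).toNat : ℤ)) = q.num := by lia
  have h1' : ((q.num.toNat : ℚ) - ((-q.num).toNat : ℚ)) = q.num := by exact_mod_cast h1
  have h2 : ((q.den - 1 : ℕ) : ℚ) + 1 = q.den := by
    have := q.pos
    exact_mod_cast (by lia : q.den - 1 + 1 = q.den)
  rw [ratCode_pair, h1', h2, Rat.num_div_den]

theorem exists_ratCode_btwn {a b : ℝ} (h : a < b) :
    ∃ c, a < (ratCode c : ℝ) ∧ (ratCode c : ℝ) < b := by
  obtain ⟨q, h1, h2⟩ := exists_rat_btwn h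
  obtain ⟨c, rfl⟩ := ratCode_surjective q
  exact ⟨c, h1, h2⟩

theorem Primrec.two_pow : Primrec fun n : ℕ => 2 ^ n := by
  refine (Primrec.nat_rec₁ (f := fun _ y => y * 2) 1
    (show Primrec fun z : ℕ × ℕ => z.2 * 2 by fun_prop)).of_eq fun n => ?_
  induction n with
  | zero => rfl
  | succ n ih => rw [pow_succ, ← ih]

/-- A real-valued function whose values are rationals with primitive recursive codes. -/
def PrimrecReal {α : Type} [Primcodable α] (f : α → ℝ) : Prop :=
  ∃ g : α → ℕ, Primrec g ∧ ∀ a, f a = (ratCode (g a) : ℝ)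

namespace PrimrecReal

variable {α : Type} [Primcodable α] {f g : α → ℝ}

theorem ratCode_apply {u : α → ℕ} (hu : Primrec u) : PrimrecReal fun a => (ratCode (u a) : ℝ) :=
  ⟨u, hu, fun _ => rfl⟩

theorem add (hf : PrimrecReal f) (hg : PrimrecReal g) : PrimrecReal fun a => f a + g a := by
  obtain ⟨u, hu, hu'⟩ := hf
  obtain ⟨v, hv, hv'⟩ := hg
  -- The code stores the denominator minus one, and `(c + 1) * (c' + 1) = (c * c' + c + c') + 1`.
  refine ⟨fun a => Nat.pair
    ((u a).unpair.1 * ((v a).unpair.2.unpair.2 + 1) + (v a).unpair.1 * ((u a).unpair.2.unpair.2 + 1))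
    (Nat.pair ((u a).unpair.2.unpair.1 * ((v a).unpair.2.unpair.2 + 1)
      + (v a).unpair.2.unpair.1 * ((u a).unpair.2.unpair.2 + 1))
      ((u a).unpair.2.unpair.2 * (v a).unpair.2.unpair.2 + (u a).unpair.2.unpair.2
        + (v a).unpair.2.unpair.2)), by fun_prop, fun a => ?_⟩
  beta_reduce
  rw [hu', hv', ratCode_pair, ratCode, ratCode, ← Rat.cast_add]
  rw [div_add_div _ _ (by positivity) (by positivity)]
  push_cast
  congr 1 <;> ring

theorem neg (hf : PrimrecReal f) : PrimrecReal fun a => -f a := by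
  obtain ⟨u, hu, hu'⟩ := hf
  refine ⟨fun a => Nat.pair (u a).unpair.2.unpair.1
    (Nat.pair (u a).unpair.1 (u a).unpair.2.unpair.2), by fun_prop, fun a => ?_⟩
  beta_reduce
  rw [hu', ratCode_pair, ratCode, ← Rat.cast_neg, ← neg_div, neg_sub]

theorem sub (hf : PrimrecReal f) (hg : PrimrecReal g) : PrimrecReal fun a => f a - g a := by
  simpa only [sub_eq_add_neg] using hf.add hg.neg

theorem mul (hf : PrimrecReal f) (hg : PrimrecReal g) : PrimrecReal fun a => f a * g a := by
  obtain ⟨u, hu, hu'⟩ := hf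
  obtain ⟨v, hv, hv'⟩ := hg
  refine ⟨fun a => Nat.pair
    ((u a).unpair.1 * (v a).unpair.1 + (u a).unpair.2.unpair.1 * (v a).unpair.2.unpair.1)
    (Nat.pair ((u a).unpair.1 * (v a).unpair.2.unpair.1 + (u a).unpair.2.unpair.1 * (v a).unpair.1)
      ((u a).unpair.2.unpair.2 * (v a).unpair.2.unpair.2 + (u a).unpair.2.unpair.2
        + (v a).unpair.2.unpair.2)), by fun_prop, fun a => ?_⟩
  beta_reduce
  rw [hu', hv', ratCode_pair, ratCode, ratCode, ← Rat.cast_mul, div_mul_div_comm]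
  push_cast
  congr 1 <;> ring

theorem natCast {u : α → ℕ} (hu : Primrec u) : PrimrecReal fun a => (u a : ℝ) :=
  ⟨fun a => Nat.pair (u a) (Nat.pair 0 0), by fun_prop, fun a => by simp [ratCode_pair]⟩

theorem zero : PrimrecReal fun _ : α => 0 := by
  simpa using natCast (α := α) (Primrec.const 0)

theorem div_succ (hf : PrimrecReal f) {u : α → ℕ} (hu : Primrec u) :
    PrimrecReal fun a => f a / ((u a : ℝ) + 1) := by
  have : PrimrecReal fun a => 1 / ((u a : ℝ) + 1) :=
    ⟨fun a => Nat.pair 1 (Nat.pair 0 (u a)), by fun_prop, fun a => by simp [ratCode_pair]⟩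
  simpa only [mul_one_div] using hf.mul this

theorem half_pow {u : α → ℕ} (hu : Primrec u) : PrimrecReal fun a => (2 : ℝ)⁻¹ ^ u a := by
  refine ⟨fun a => Nat.pair 1 (Nat.pair 0 (2 ^ u a - 1)), ?_, fun a => ?_⟩
  · have := Primrec.two_pow.comp hu
    fun_prop
  · have : ((2 ^ u a - 1 : ℕ) : ℚ) + 1 = 2 ^ u a := by
      have : 0 < 2 ^ u a := by positivity
      exact_mod_cast (by lia : 2 ^ u a - 1 + 1 = 2 ^ u a)
    rw [ratCode_pair, this]
    simp

end PrimrecReal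

theorem SemiDec.real_lt {α : Type} [Primcodable α] {f g : α → ℝ} (hf : PrimrecReal f)
    (hg : PrimrecReal g) : SemiDec fun a => f a < g a := by
  obtain ⟨u, hu, hu'⟩ := hf
  obtain ⟨v, hv, hv'⟩ := hg
  refine SemiDec.of_iff (SemiDec.of_primrecPred (Primrec.nat_lt.comp
    (f := fun a => (u a).unpair.1 * ((v a).unpair.2.unpair.2 + 1) +
      (v a).unpair.2.unpair.1 * ((u a).unpair.2.unpair.2 + 1))
    (g := fun a => (v a).unpair.1 * ((u a).unpair.2.unpair.2 + 1) +
      (u a).unpair.2.unpair.1 * ((v a).unpair.2.unpair.2 + 1))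
    (by fun_prop) (by fun_prop))) fun a => ?_
  rw [hu', hv', ratCode, ratCode, Rat.cast_lt, div_lt_div_iff₀ (by positivity) (by positivity),
    ← Nat.cast_lt (α := ℚ)]
  push_cast
  constructor <;> intro h <;> linarith

/-! ## Rational vectors and balls -/

theorem ratVec_apply (d e : ℕ) (i : Fin d) :
    ratVec d e i = (ratCode ((Denumerable.ofNat (List ℕ) e).getD i 0) : ℝ) := rfl

theorem ratVec_zero (d : ℕ) : ratVec d 0 = 0 := by
  ext i
  have : Denumerable.ofNat (List ℕ) 0 = [] := by simp
  simp [ratVec_apply, this, ratCode_zero]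

/-- A distance of rational vectors may be irrational, but its square is rational; all comparisons of
distances go through squares. -/
theorem PrimrecReal.dist_sq (d : ℕ) {α : Type} [Primcodable α] {u v : α → ℕ} (hu : Primrec u)
    (hv : Primrec v) : PrimrecReal fun a => dist (ratVec d (u a)) (ratVec d (v a)) ^ 2 := by
  let c : α → ℕ → ℝ := fun a i => (ratCode ((Denumerable.ofNat (List ℕ) (u a)).getD i 0) : ℝ) -
    (ratCode ((Denumerable.ofNat (List ℕ) (v a)).getD i 0) : ℝ)
  have hc : ∀ i, PrimrecReal fun a => c a i := fun i =>
    (PrimrecReal.ratCode_apply (by fun_prop)).sub (PrimrecReal.ratCode_apply (by fun_prop))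
  have h : ∀ k, PrimrecReal fun a => ∑ i ∈ Finset.range k, c a i * c a i := by
    intro k
    induction k with
    | zero => simpa using PrimrecReal.zero (α := α)
    | succ k ih => simpa only [Finset.sum_range_succ] using ih.add ((hc k).mul (hc k))
  convert! h d using 2 with a
  rw [EuclideanSpace.dist_sq_eq, ← Fin.sum_univ_eq_sum_range (fun i => c a i * c a i)]
  refine Finset.sum_congr rfl fun i _ => ?_
  rw [Real.dist_eq, sq_abs, sq]
  rfl

theorem SemiDec.dist_lt (d : ℕ) {α : Type} [Primcodable α] {u v : α → ℕ} {f : α → ℝ}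
    (hu : Primrec u) (hv : Primrec v) (hf : PrimrecReal f) :
    SemiDec fun a => dist (ratVec d (u a)) (ratVec d (v a)) < f a := by
  refine SemiDec.of_iff ((SemiDec.real_lt PrimrecReal.zero hf).and
      (SemiDec.real_lt (PrimrecReal.dist_sq d hu hv) (hf.mul hf))) fun a => ?_
  rw [← sq]
  refine ⟨fun h => ⟨dist_nonneg.trans_lt h, ?_⟩, fun h => lt_of_pow_lt_pow_left₀ 2 h.1.le h.2⟩
  gcongr

/-- Squares decide the comparison only if the bound is nonnegative; a negative bound is treated
separately. -/
theorem SemiDec.lt_dist (d : ℕ) {α : Type} [Primcodable α] {u v : α → ℕ} {f : α → ℝ}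
    (hu : Primrec u) (hv : Primrec v) (hf : PrimrecReal f) :
    SemiDec fun a => f a < dist (ratVec d (u a)) (ratVec d (v a)) := by
  refine SemiDec.of_iff ((SemiDec.real_lt hf PrimrecReal.zero).or
      (SemiDec.real_lt (hf.mul hf) (PrimrecReal.dist_sq d hu hv))) fun a => ?_
  rw [← sq]
  constructor
  · intro h
    rcases lt_or_ge (f a) 0 with h0 | h0
    · exact Or.inl h0
    · exact Or.inr (by gcongr)
  · rintro (h | h)
    · exact h.trans_le dist_nonneg
    · exact lt_of_pow_lt_pow_left₀ 2 dist_nonneg h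

/-- The center of a rational ball. -/
noncomputable def ctr (d e : ℕ) : Euc d := ratVec d e.unpair.1

/-- The radius of a rational ball. -/
noncomputable def rad (e : ℕ) : ℝ := (ratCode e.unpair.2 : ℝ)

theorem mem_ratBall {d e : ℕ} {x : Euc d} : x ∈ ratBall d e ↔ dist x (ctr d e) < rad e := Iff.rfl

theorem PrimrecReal.rad {α : Type} [Primcodable α] {u : α → ℕ} (hu : Primrec u) :
    PrimrecReal fun a => rad (u a) :=
  PrimrecReal.ratCode_apply (by fun_prop)

theorem ratBall_zero (d : ℕ) : ratBall d 0 = ∅ := by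
  simp [ratBall, ratCode_zero]

theorem isOpen_ratBall (d e : ℕ) : IsOpen (ratBall d e) := Metric.isOpen_ball

theorem exists_dist_ratVec_lt {d : ℕ} (x : Euc d) {ε : ℝ} (hε : 0 < ε) :
    ∃ c, dist x (ratVec d c) < ε := by
  have h1 : DenseRange fun q : Fin d → ℚ => (WithLp.toLp 2 fun i => (q i : ℝ) : Euc d) := by
    have h2 : DenseRange (Pi.map fun (_ : Fin d) (q : ℚ) => (q : ℝ)) :=
      DenseRange.piMap fun _ => Rat.denseRange_cast
    exact (WithLp.toLp_surjective 2).denseRange.comp h2 (PiLp.continuous_toLp 2 _)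
  obtain ⟨q, hq⟩ := h1.exists_dist_lt x hε
  choose c hc using fun i => ratCode_surjective (q i)
  refine ⟨Encodable.encode (List.ofFn c), ?_⟩
  have : ratVec d (Encodable.encode (List.ofFn c)) = WithLp.toLp 2 fun i => (q i : ℝ) := by
    ext i
    simp [ratVec_apply, hc]
  rwa [this]

/-! ### Rational balls shrinking to a point -/

/-- The filter of the codes of the rational balls that shrink to `x`. -/
noncomputable def ballsAt (d : ℕ) (x : Euc d) : Filter ℕ :=
  comap rad (𝓝 0) ⊓ 𝓟 {e | x ∈ ratBall d e}

section ballsAt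

variable {d : ℕ} {x : Euc d}

theorem eventually_mem_ratBall : ∀ᶠ e in ballsAt d x, x ∈ ratBall d e :=
  mem_inf_of_right (mem_principal_self _)

theorem tendsto_rad : Tendsto rad (ballsAt d x) (𝓝 0) :=
  tendsto_comap.mono_left inf_le_left

theorem tendsto_ctr : Tendsto (ctr d) (ballsAt d x) (𝓝 x) := by
  rw [tendsto_iff_dist_tendsto_zero]
  refine squeeze_zero' (Eventually.of_forall fun _ => dist_nonneg) ?_ (tendsto_rad (x := x))
  filter_upwards [eventually_mem_ratBall] with e he
  rw [dist_comm]
  exact (mem_ratBall.1 he).le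

instance ballsAt_neBot : (ballsAt d x).NeBot := by
  rw [ballsAt, inf_principal_neBot_iff]
  rintro U ⟨V, hV, hU⟩
  obtain ⟨ε, hε, hV⟩ := Metric.mem_nhds_iff.1 hV
  obtain ⟨r, hr, hr'⟩ := exists_ratCode_btwn hε
  obtain ⟨c, hc⟩ := exists_dist_ratVec_lt x hr
  refine ⟨Nat.pair c r, hU (hV ?_), ?_⟩
  · rw [mem_ball_zero_iff, rad, Nat.unpair_pair, Real.norm_eq_abs, abs_of_pos hr]
    exact hr'
  · simpa [mem_ratBall, ctr, rad] using hc

/-- The strict inequality holds in the limit, with center `x` and radius `0`, so it persists nearby.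
The completeness conditions for formal inclusions and distance bounds come from this. -/
theorem eventually_dist_lt {y : Euc d} {r t : ℝ} (h : dist x y + t < r) :
    ∀ᶠ e in ballsAt d x, dist (ctr d e) y < r - rad e - t := by
  have h1 : Tendsto (fun e => dist (ctr d e) y + rad e + t) (ballsAt d x) (𝓝 (dist x y + 0 + t)) :=
    ((tendsto_ctr.dist tendsto_const_nhds).add tendsto_rad).add tendsto_const_nhds
  filter_upwards [h1.eventually_lt_const (by linarith : dist x y + 0 + t < r)] with e he
  linarith

theorem eventually_rad_lt {r : ℝ} (h : 0 < r) : ∀ᶠ e in ballsAt d x, rad e < r :=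
  tendsto_rad.eventually_lt_const h

theorem eventually_rad_pos : ∀ᶠ e in ballsAt d x, 0 < rad e := by
  filter_upwards [eventually_mem_ratBall] with e he using dist_nonneg.trans_lt (mem_ratBall.1 he)

end ballsAt

theorem exists_half_pow_lt {r : ℝ} (h : 0 < r) : ∃ k : ℕ, (2 : ℝ)⁻¹ ^ k < r :=
  exists_pow_lt_of_lt_one h (by norm_num)

/-! ### Formal inclusion of rational balls -/

/-- The ball `e` lies in the ball `e'`, at distance more than `t` from its boundary. -/
def Inside (d e e' : ℕ) (t : ℝ) : Prop := dist (ctr d e) (ctr d e') < rad e' - rad e - t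

theorem SemiDec.inside (d : ℕ) {α : Type} [Primcodable α] {u v : α → ℕ} {f : α → ℝ}
    (hu : Primrec u) (hv : Primrec v) (hf : PrimrecReal f) :
    SemiDec fun a => Inside d (u a) (v a) (f a) :=
  SemiDec.dist_lt d (u := fun a => (u a).unpair.1) (v := fun a => (v a).unpair.1) (by fun_prop)
    (by fun_prop) (((PrimrecReal.rad hv).sub (PrimrecReal.rad hu)).sub hf)

theorem Inside.mem {d e e' : ℕ} {t : ℝ} (h : Inside d e e' t) {x y : Euc d}
    (hx : x ∈ ratBall d e) (hy : dist y x ≤ t) : y ∈ ratBall d e' := by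
  rw [mem_ratBall] at *
  have := dist_triangle4 y x (ctr d e) (ctr d e')
  rw [Inside] at h
  linarith

theorem Inside.subset {d e e' : ℕ} (h : Inside d e e' 0) : ratBall d e ⊆ ratBall d e' :=
  fun _ hx => h.mem hx (by simp)

theorem eventually_inside {d e' : ℕ} {x : Euc d} (h : x ∈ ratBall d e') :
    ∀ᶠ e in ballsAt d x, Inside d e e' 0 :=
  eventually_dist_lt (by simpa using mem_ratBall.1 h)

theorem exists_eventually_inside {d e' : ℕ} {x : Euc d} (h : x ∈ ratBall d e') :
    ∃ k : ℕ, ∀ᶠ e in ballsAt d x, Inside d e e' (2⁻¹ ^ k) := by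
  rw [mem_ratBall] at h
  obtain ⟨k, hk⟩ := exists_half_pow_lt (sub_pos.2 h)
  exact ⟨k, eventually_dist_lt (by linarith)⟩

/-! ## Names of points and rational balls -/

/-- The ball `e` lies in the ball with center `wᵢ` and radius `2⁻ⁱ` for all letters `wᵢ`. -/
def WordInside (d e : ℕ) (w : List ℕ) : Prop :=
  ∀ i < w.length, dist (ctr d e) (ratVec d (w.getD i 0)) < 2⁻¹ ^ i - rad e

/-- Some letter `wᵢ` shows that the points with a name that starts with `w` lie in the ball `e`. -/
def Near (d : ℕ) (w : List ℕ) (e : ℕ) : Prop :=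
  ∃ i, i < w.length ∧ dist (ratVec d (w.getD i 0)) (ctr d e) < rad e - 2⁻¹ ^ i

section names

variable {d : ℕ} {x : Euc d} {p : ℕ → ℕ}

theorem SemiDec.wordInside (d : ℕ) {α : Type} [Primcodable α] {u : α → ℕ} {w : α → List ℕ}
    (hu : Primrec u) (hw : Primrec w) : SemiDec fun a => WordInside d (u a) (w a) :=
  SemiDec.forall_lt (P := fun a i => dist (ctr d (u a)) (ratVec d ((w a).getD i 0)) <
      2⁻¹ ^ i - rad (u a))
    (SemiDec.dist_lt d (u := fun z : α × ℕ => (u z.1).unpair.1)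
      (v := fun z : α × ℕ => (w z.1).getD z.2 0) (by fun_prop) (by fun_prop)
      ((PrimrecReal.half_pow (by fun_prop)).sub (PrimrecReal.rad (by fun_prop)))) (by fun_prop)

theorem SemiDec.near (d : ℕ) {α : Type} [Primcodable α] {w : α → List ℕ} {u : α → ℕ}
    (hw : Primrec w) (hu : Primrec u) : SemiDec fun a => Near d (w a) (u a) :=
  SemiDec.ex (SemiDec.and (SemiDec.of_primrecPred (Primrec.nat_lt.comp
      (f := fun z : α × ℕ => z.2) (g := fun z : α × ℕ => (w z.1).length) (by fun_prop)
      (by fun_prop)))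
    (SemiDec.dist_lt d (u := fun z : α × ℕ => (w z.1).getD z.2 0)
      (v := fun z : α × ℕ => (u z.1).unpair.1) (by fun_prop) (by fun_prop)
      ((PrimrecReal.rad (by fun_prop)).sub (PrimrecReal.half_pow (by fun_prop)))))

theorem cauchyNaming.dist_lt (h : cauchyNaming d p x) (j : ℕ) :
    dist x (ratVec d (p j)) < 2⁻¹ ^ j := by
  rw [dist_eq_norm]
  exact h j

theorem exists_cauchyNaming (x : Euc d) : ∃ p, cauchyNaming d p x := by
  choose p hp using fun j : ℕ => exists_dist_ratVec_lt x (ε := 2⁻¹ ^ j) (by positivity)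
  exact ⟨p, fun j => by simpa only [dist_eq_norm] using hp j⟩

/-- By the triangle inequality each letter of `w` is an admissible approximation of `x`; after `w`,
any name of `x` may take over. -/
theorem WordInside.exists_name {e : ℕ} {w : List ℕ} (h : WordInside d e w)
    (hx : x ∈ ratBall d e) : ∃ p, cauchyNaming d p x ∧ initSeg p w.length = w := by
  obtain ⟨g, hg⟩ := exists_cauchyNaming x
  refine ⟨extendWord w g, fun j => ?_, initSeg_extendWord w g⟩
  rcases lt_or_ge j w.length with hj | hj
  · rw [extendWord_of_lt w g hj 0, ← dist_eq_norm]
    have h1 := h j hj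
    have h2 := dist_triangle x (ctr d e) (ratVec d (w.getD j 0))
    have h3 := mem_ratBall.1 hx
    linarith
  · rw [extendWord_of_le w g hj]
    exact hg j

theorem cauchyNaming.eventually_wordInside (h : cauchyNaming d p x) (k : ℕ) :
    ∀ᶠ e in ballsAt d x, WordInside d e (initSeg p k) := by
  have h1 : ∀ i ∈ Finset.range k,
      ∀ᶠ e in ballsAt d x, dist (ctr d e) (ratVec d (p i)) < 2⁻¹ ^ i - rad e - 0 :=
    fun i _ => eventually_dist_lt (by simpa using h.dist_lt i)
  filter_upwards [(Finset.eventually_all _).2 h1] with e he i hi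
  rw [length_initSeg] at hi
  rw [getD_initSeg hi]
  simpa using he i (Finset.mem_range.2 hi)

theorem Near.mem (hp : cauchyNaming d p x) {k e : ℕ} (h : Near d (initSeg p k) e) :
    x ∈ ratBall d e := by
  obtain ⟨i, hi, h⟩ := h
  rw [length_initSeg] at hi
  rw [getD_initSeg hi] at h
  rw [mem_ratBall]
  have h1 := hp.dist_lt i
  have h2 := dist_triangle x (ratVec d (p i)) (ctr d e)
  linarith

theorem cauchyNaming.exists_near (hp : cauchyNaming d p x) {e : ℕ} (h : x ∈ ratBall d e) :
    ∃ k, Near d (initSeg p k) e := by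
  rw [mem_ratBall] at h
  -- The error `2⁻ⁱ` counts twice: in replacing `x` by the letter, and as the margin that `Near`
  -- demands.
  obtain ⟨i, hi⟩ := exists_half_pow_lt (half_pos (sub_pos.2 h))
  refine ⟨i + 1, i, by simp [length_initSeg], ?_⟩
  rw [getD_initSeg i.lt_succ_self]
  have h1 := hp.dist_lt i
  have h2 := dist_triangle_left (ratVec d (p i)) (ctr d e) x
  linarith

end names

/-- The code of the ball with center `c` and radius `2⁻ⁱ`. -/
def powBall (c i : ℕ) : ℕ := Nat.pair c (Nat.pair 1 (Nat.pair 0 (2 ^ i - 1)))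

theorem rad_powBall (c i : ℕ) : rad (powBall c i) = 2⁻¹ ^ i := by
  have : ((2 ^ i - 1 : ℕ) : ℚ) + 1 = 2 ^ i := by
    have : 0 < 2 ^ i := by positivity
    exact_mod_cast (by lia : 2 ^ i - 1 + 1 = 2 ^ i)
  rw [rad, powBall, Nat.unpair_pair, ratCode_pair, this]
  simp

theorem ctr_powBall (d c i : ℕ) : ctr d (powBall c i) = ratVec d c := by
  simp [ctr, powBall]

theorem Primrec.powBall_apply {α : Type} [Primcodable α] {u v : α → ℕ} (hu : Primrec u)
    (hv : Primrec v) : Primrec fun a => powBall (u a) (v a) := by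
  have := Primrec.two_pow.comp hv
  unfold powBall
  fun_prop

theorem cauchyNaming.mem_powBall {d : ℕ} {p : ℕ → ℕ} {x : Euc d} (hp : cauchyNaming d p x) (i : ℕ) :
    x ∈ ratBall d (powBall (p i) i) := by
  rw [mem_ratBall, ctr_powBall, rad_powBall]
  exact hp.dist_lt i

theorem cauchyNaming_iff {d : ℕ} {p : ℕ → ℕ} {x : Euc d} :
    cauchyNaming d p x ↔ ∀ i, x ∈ ratBall d (powBall (p i) i) := by
  refine ⟨fun h => h.mem_powBall, fun h j => ?_⟩
  have := h j
  rwa [mem_ratBall, ctr_powBall, rad_powBall, dist_eq_norm] at this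

theorem cauchyNaming.exists_inside {d : ℕ} {p : ℕ → ℕ} {x : Euc d} (hp : cauchyNaming d p x)
    {e : ℕ} (h : x ∈ ratBall d e) : ∃ i, Inside d (powBall (p i) i) e 0 := by
  rw [mem_ratBall] at h
  obtain ⟨i, hi⟩ := exists_half_pow_lt (half_pos (sub_pos.2 h))
  refine ⟨i, ?_⟩
  rw [Inside, ctr_powBall, rad_powBall]
  have h1 := hp.dist_lt i
  have h2 := dist_triangle_left (ratVec d (p i)) (ctr d e) x
  linarith

/-! ## Computability in terms of rational balls -/

section characterizations

variable {n m : ℕ} {X : Set (Euc n)} {f : X → Euc m}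

theorem isComputableMap_iff {A B : Type} {δ : Naming A} {γ : Naming B} {f : A → B} :
    IsComputableMap δ γ f ↔
      ∃ M : Type2Machine, ∀ p x, δ p x → ∃ q, M.Produces p q ∧ γ q (f x) := by
  simp [IsComputableMap, IsComputableMulti]

theorem SemiDec.out (M : Type2Machine) {α : Type} [Primcodable α] {w : α → List ℕ} {u v : α → ℕ}
    (hw : Primrec w) (hu : Primrec u) (hv : Primrec v) :
    SemiDec fun a => (M.out (w a))[u a]? = some (v a) :=
  M.semiDec_out.comp₃ (P := fun w i o => (M.out w)[i]? = some o) hw hu hv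

/-- The output of `M` on `w`, read as the beginning of a name of a point, shows that this point lies
in the ball `d`. -/
def OutputNear (M : Type2Machine) (m : ℕ) (w : List ℕ) (d : ℕ) : Prop :=
  ∃ i o, (M.out w)[i]? = some o ∧ Inside m (powBall o i) d 0

theorem SemiDec.outputNear (M : Type2Machine) (m : ℕ) {α : Type} [Primcodable α] {w : α → List ℕ}
    {u : α → ℕ} (hw : Primrec w) (hu : Primrec u) : SemiDec fun a => OutputNear M m (w a) (u a) := by
  have h1 : SemiDec fun z : (α × ℕ) × ℕ => (M.out (w z.1.1))[z.1.2]? = some z.2 :=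
    SemiDec.out M (by fun_prop) (by fun_prop) (by fun_prop)
  have h2 : Primrec fun z : (α × ℕ) × ℕ => powBall z.2 z.1.2 :=
    Primrec.powBall_apply (by fun_prop) (by fun_prop)
  have h3 : SemiDec fun z : (α × ℕ) × ℕ => Inside m (powBall z.2 z.1.2) (u z.1.1) 0 :=
    SemiDec.inside m h2 (by fun_prop) PrimrecReal.zero
  exact SemiDec.ex (SemiDec.ex (h1.and h3))

theorem OutputNear.mem {M : Type2Machine} {k d : ℕ} {p q : ℕ → ℕ} {y : Euc m}
    (h : OutputNear M m (initSeg p k) d) (hq : M.Produces p q) (hy : cauchyNaming m q y) :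
    y ∈ ratBall m d := by
  obtain ⟨i, o, ho, hd⟩ := h
  rw [hq.eq ho] at hd
  exact hd.subset (hy.mem_powBall i)

theorem Type2Machine.Produces.exists_outputNear {M : Type2Machine} {d : ℕ} {p q : ℕ → ℕ} {y : Euc m}
    (hq : M.Produces p q) (hy : cauchyNaming m q y) (h : y ∈ ratBall m d) :
    ∃ k, 0 < k ∧ OutputNear M m (initSeg p k) d := by
  obtain ⟨i, hi⟩ := cauchyNaming.exists_inside hy h
  obtain ⟨k, hk⟩ := hq i
  -- One more letter makes the word nonempty, which matters where its first letter is to be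
  -- inspected.
  exact ⟨k + 1, k.succ_pos, i, q i,
    (M.mono_out _ _ (initSeg_prefix _ k.le_succ)).getElem?_eq_some_of hk, hi⟩

/-- A function is computable iff the pairs of balls `(e, d)` with `f[e] ⊆ d` can be enumerated
sufficiently well. -/
theorem isComputableFun_iff : IsComputableFun f ↔
    ∃ S : ℕ → ℕ → Prop, (SemiDec fun z : ℕ × ℕ => S z.1 z.2) ∧
      (∀ (x : X) e d, S e d → (x : Euc n) ∈ ratBall n e → f x ∈ ratBall m d) ∧
      ∀ (x : X) d, f x ∈ ratBall m d → ∀ᶠ e in ballsAt n x, S e d := by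
  rw [IsComputableFun, isComputableMap_iff]
  constructor
  · rintro ⟨M, hM⟩
    -- The word `w` begins a name of every point of `e`, so the bound read off from the output on
    -- `w` holds for the values at all of them.
    refine ⟨fun e d => ∃ w, WordInside n e w ∧ OutputNear M m w d, ?_, ?_, ?_⟩
    · exact SemiDec.ex_list (SemiDec.and (SemiDec.wordInside n (by fun_prop) (by fun_prop))
        (SemiDec.outputNear M m (by fun_prop) (by fun_prop)))
    · rintro x e d ⟨w, hw, ho⟩ hx
      obtain ⟨p, hp, hpw⟩ := hw.exists_name hx
      obtain ⟨q, hq, hq'⟩ := hM p x hp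
      rw [← hpw] at ho
      exact ho.mem hq hq'
    · intro x d hd
      obtain ⟨p, hp⟩ := exists_cauchyNaming (x : Euc n)
      obtain ⟨q, hq, hq'⟩ := hM p x hp
      obtain ⟨k, -, hk⟩ := hq.exists_outputNear hq' hd
      filter_upwards [hp.eventually_wordInside k] with e he using ⟨_, he, hk⟩
  · rintro ⟨S, hS, hsound, hcomplete⟩
    obtain ⟨M, hM⟩ := Type2Machine.exists_of_semiDec
      (R := fun w i o => ∃ e, Near n w e ∧ S e (powBall o i))
      (SemiDec.ex (SemiDec.and (SemiDec.near n (by fun_prop) (by fun_prop))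
        (hS.comp₂ (by fun_prop) (Primrec.powBall_apply (by fun_prop) (by fun_prop)))))
    refine ⟨M, fun p x hp => ?_⟩
    replace hp : cauchyNaming n p x := hp
    -- This name need not be computable; it only shows that the search for each output succeeds.
    obtain ⟨o, ho⟩ := exists_cauchyNaming (f x)
    obtain ⟨q, hq, hq'⟩ := hM p fun i => by
      obtain ⟨e, he, he'⟩ :=
        ((hcomplete x _ (ho.mem_powBall i)).and eventually_mem_ratBall).exists
      obtain ⟨k, hk⟩ := hp.exists_near he'
      exact ⟨k, o i, e, hk, he⟩
    refine ⟨q, hq, cauchyNaming_iff.2 fun i => ?_⟩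
    obtain ⟨k, e, he, he'⟩ := hq' i
    exact hsound x e _ he' (he.mem hp)

/-- A sequence of points is computable iff the balls that contain its members can be enumerated. -/
theorem isComputableMap_nat_iff {y : ℕ → Euc m} : IsComputableMap natNaming (cauchyNaming m) y ↔
    SemiDec fun z : ℕ × ℕ => y z.1 ∈ ratBall m z.2 := by
  rw [isComputableMap_iff]
  constructor
  · rintro ⟨M, hM⟩
    -- Only the first letter of a name of a number matters, so every word starting with `z.1` begins
    -- a name of it.
    refine SemiDec.of_iff (P := fun z : ℕ × ℕ => ∃ w : List ℕ, (0 < w.length ∧ w.getD 0 0 = z.1) ∧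
      OutputNear M m w z.2) ?_ fun z => ?_
    · exact SemiDec.ex_list (SemiDec.and (SemiDec.of_primrecPred ((Primrec.nat_lt.comp
        (by fun_prop) (by fun_prop)).and (Primrec.eq.comp (by fun_prop) (by fun_prop))))
        (SemiDec.outputNear M m (by fun_prop) (by fun_prop)))
    · constructor
      · intro hz
        obtain ⟨q, hq, hq'⟩ := hM (fun _ => z.1) z.1 rfl
        obtain ⟨k, hk0, hk⟩ := hq.exists_outputNear hq' hz
        exact ⟨_, ⟨by rwa [length_initSeg], getD_initSeg hk0⟩, hk⟩
      · rintro ⟨w, ⟨hw, hw'⟩, ho⟩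
        obtain ⟨q, hq, hq'⟩ := hM (extendWord w fun _ => 0) z.1
          ((extendWord_of_lt w _ hw 0).trans hw')
        rw [← initSeg_extendWord w fun _ => 0] at ho
        exact ho.mem hq hq'
  · intro hS
    obtain ⟨M, hM⟩ := Type2Machine.exists_of_semiDec
      (R := fun w i o => 0 < w.length ∧ y (w.getD 0 0) ∈ ratBall m (powBall o i))
      (SemiDec.and (SemiDec.of_primrecPred (Primrec.nat_lt.comp (by fun_prop) (by fun_prop)))
        (hS.comp₂ (P := fun j e => y j ∈ ratBall m e) (by fun_prop)
          (Primrec.powBall_apply (by fun_prop) (by fun_prop))))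
    refine ⟨M, fun p j hp => ?_⟩
    replace hp : p 0 = j := hp
    obtain ⟨o, ho⟩ := exists_cauchyNaming (y j)
    obtain ⟨q, hq, hq'⟩ := hM p fun i => by
      refine ⟨1, o i, by simp [initSeg], ?_⟩
      rw [getD_initSeg one_pos, hp]
      exact ho.mem_powBall i
    refine ⟨q, hq, cauchyNaming_iff.2 fun i => ?_⟩
    obtain ⟨k, hk, hk'⟩ := hq' i
    rw [length_initSeg] at hk
    rwa [getD_initSeg hk, hp] at hk'

/-- A name of the pair of a point and a number. -/
theorem prod_natNaming_pair {p : ℕ → ℕ} {x : X} (hp : cauchyNaming n p x) (k : ℕ) :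
    ((cauchyNaming n).restrict X).prod natNaming (fun i => Nat.pair (p i) k) (x, k) := by
  refine ⟨?_, ?_⟩
  · simpa [Naming.restrict] using hp
  · simp [natNaming]

theorem Primrec.map_pair {α : Type} [Primcodable α] {w : α → List ℕ} {k : α → ℕ} (hw : Primrec w)
    (hk : Primrec k) : Primrec fun a => (w a).map fun i => Nat.pair i (k a) :=
  Primrec.list_map hw (show Primrec fun z : α × ℕ => Nat.pair z.2 (k z.1) by fun_prop)

theorem Primrec.map_unpair_fst {α : Type} [Primcodable α] {w : α → List ℕ} (hw : Primrec w) :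
    Primrec fun a => (w a).map fun i => i.unpair.1 :=
  Primrec.list_map hw (show Primrec fun z : α × ℕ => z.2.unpair.1 by fun_prop)

/-- There is a computable multi-valued function with `P x k l` for all values `l` at `(x, k)` iff
such values can be found from small balls around `x`. -/
theorem exists_isComputableModulus_iff {P : X → ℕ → ℕ → Prop} :
    (∃ μ : X × ℕ → Set ℕ, IsComputableModulus μ ∧
      ∀ x k, (μ (x, k)).Nonempty ∧ ∀ l ∈ μ (x, k), P x k l) ↔
    ∃ S : ℕ → ℕ → ℕ → Prop, (SemiDec fun z : ℕ × ℕ × ℕ => S z.1 z.2.1 z.2.2) ∧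
      (∀ (x : X) e k l, S e k l → (x : Euc n) ∈ ratBall n e → P x k l) ∧
      ∀ (x : X) k, ∃ l, ∀ᶠ e in ballsAt n x, S e k l := by
  constructor
  · rintro ⟨μ, ⟨M, hM⟩, hμ⟩
    refine ⟨fun e k l => ∃ w, WordInside n e w ∧
      (M.out (w.map fun i => Nat.pair i k))[0]? = some l, ?_, ?_, ?_⟩
    · exact SemiDec.ex_list (SemiDec.and (SemiDec.wordInside n (by fun_prop) (by fun_prop))
        (SemiDec.out M (Primrec.map_pair (by fun_prop) (by fun_prop)) (by fun_prop) (by fun_prop)))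
    · rintro x e k l ⟨w, hw, ho⟩ hx
      obtain ⟨p, hp, hpw⟩ := hw.exists_name hx
      obtain ⟨q, l', hq, hl', hl⟩ := hM _ _ (prod_natNaming_pair hp k) (hμ x k).1
      rw [← hpw, initSeg_map p fun i => Nat.pair i k] at ho
      rw [hq.eq ho, show q 0 = l' from hl']
      exact (hμ x k).2 l' hl
    · intro x k
      obtain ⟨p, hp⟩ := exists_cauchyNaming (x : Euc n)
      obtain ⟨q, l', hq, hl', hl⟩ := hM _ _ (prod_natNaming_pair hp k) (hμ x k).1
      obtain ⟨K, hK⟩ := hq 0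
      refine ⟨q 0, ?_⟩
      filter_upwards [hp.eventually_wordInside K] with e he
      exact ⟨_, he, by rwa [initSeg_map p fun i => Nat.pair i k]⟩
  · rintro ⟨S, hS, hsound, hcomplete⟩
    obtain ⟨M, hM⟩ := Type2Machine.exists_of_semiDec
      (R := fun w _ l => 0 < w.length ∧ ∃ e, Near n (w.map fun i => i.unpair.1) e ∧
        S e (w.getD 0 0).unpair.2 l)
      (SemiDec.and (SemiDec.of_primrecPred (Primrec.nat_lt.comp (by fun_prop) (by fun_prop)))
        (SemiDec.ex (SemiDec.and (SemiDec.near n (Primrec.map_unpair_fst (by fun_prop))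
          (by fun_prop)) (hS.comp₃ (by fun_prop) (by fun_prop) (by fun_prop)))))
    -- All valid values are admitted; which one the machine finds may depend on the name.
    refine ⟨fun z => {l | P z.1 z.2 l}, ⟨M, ?_⟩, fun x k => ⟨?_, fun l hl => hl⟩⟩
    · rintro p ⟨x, k⟩ ⟨hp, hk⟩ -
      replace hp : cauchyNaming n (fun i => (p i).unpair.1) x := hp
      replace hk : (p 0).unpair.2 = k := hk
      obtain ⟨l, hl⟩ := hcomplete x k
      obtain ⟨e, he, he'⟩ := (hl.and eventually_mem_ratBall).exists
      obtain ⟨K, hK⟩ := hp.exists_near he'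
      have hK0 : 0 < K := by
        obtain ⟨i, hi, -⟩ := hK
        rw [length_initSeg] at hi
        lia
      obtain ⟨q, hq, hq'⟩ := hM p fun i => by
        refine ⟨K, l, by rwa [length_initSeg], e, ?_, ?_⟩
        · rwa [initSeg_map p fun i => i.unpair.1]
        · rwa [getD_initSeg hK0, hk]
      refine ⟨q, q 0, hq, rfl, ?_⟩
      obtain ⟨K, hK0, e, he, he'⟩ := hq' 0
      rw [length_initSeg] at hK0
      rw [initSeg_map p fun i => i.unpair.1] at he
      rw [getD_initSeg hK0, hk] at he'
      exact hsound x e k _ he' (he.mem hp)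
    · obtain ⟨l, hl⟩ := hcomplete x k
      obtain ⟨e, he, he'⟩ := (hl.and eventually_mem_ratBall).exists
      exact ⟨l, hsound x e k l he he'⟩

/-- A nonnegative function is lower computable iff its rational lower bounds can be found from
small balls. -/
theorem isComputableMap_lowerNaming_iff {g : X × ℕ → EReal} (hg : ∀ z, 0 ≤ g z) :
    IsComputableMap (((cauchyNaming n).restrict X).prod natNaming) lowerNaming g ↔
    ∃ S : ℕ → ℕ → ℕ → Prop, (SemiDec fun z : ℕ × ℕ × ℕ => S z.1 z.2.1 z.2.2) ∧
      (∀ (x : X) e k s, S e k s → (x : Euc n) ∈ ratBall n e →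
        (((ratCode s : ℚ) : ℝ) : EReal) ≤ g (x, k)) ∧
      ∀ (x : X) k s, (((ratCode s : ℚ) : ℝ) : EReal) < g (x, k) →
        ∃ t, ratCode s ≤ ratCode t ∧ ∀ᶠ e in ballsAt n x, S e k t := by
  rw [isComputableMap_iff]
  constructor
  · rintro ⟨M, hM⟩
    have hout : SemiDec fun z : ((ℕ × ℕ × ℕ) × List ℕ) × ℕ =>
        (M.out (z.1.2.map fun i => Nat.pair i z.1.1.2.1))[z.2]? = some z.1.1.2.2 :=
      SemiDec.out M (Primrec.map_pair (by fun_prop) (by fun_prop)) (by fun_prop) (by fun_prop)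
    refine ⟨fun e k s => ∃ w, WordInside n e w ∧
      ∃ i : ℕ, (M.out (w.map fun i => Nat.pair i k))[i]? = some s, ?_, ?_, ?_⟩
    · exact SemiDec.ex_list (SemiDec.and (SemiDec.wordInside n (by fun_prop) (by fun_prop))
        (SemiDec.ex hout))
    · rintro x e k s ⟨w, hw, i, ho⟩ hx
      obtain ⟨p, hp, hpw⟩ := hw.exists_name hx
      obtain ⟨q, hq, hq'⟩ := hM _ _ (prod_natNaming_pair hp k)
      rw [← hpw, initSeg_map p fun i => Nat.pair i k] at ho
      rw [hq.eq ho]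
      exact hq'.1 ⟨i, rfl⟩
    · intro x k s hs
      obtain ⟨p, hp⟩ := exists_cauchyNaming (x : Euc n)
      obtain ⟨q, hq, hq'⟩ := hM _ _ (prod_natNaming_pair hp k)
      obtain ⟨_, ⟨i, rfl⟩, hi⟩ := (lt_isLUB_iff hq').1 hs
      obtain ⟨K, hK⟩ := hq i
      replace hi : (((ratCode s : ℚ) : ℝ) : EReal) < ((ratCode (q i) : ℚ) : ℝ) := hi
      -- A name of the supremum need not list `s` itself, only some rational above it; hence the
      -- detour over `t` in the completeness condition.
      refine ⟨q i, by exact_mod_cast hi.le, ?_⟩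
      filter_upwards [hp.eventually_wordInside K] with e he
      exact ⟨_, he, i, by rwa [initSeg_map p fun i => Nat.pair i k]⟩
  · rintro ⟨S, hS, hsound, hcomplete⟩
    obtain ⟨M, hM⟩ := Type2Machine.exists_enumerating
      (E := fun w s => 0 < w.length ∧ ∃ e, Near n (w.map fun i => i.unpair.1) e ∧
        S e (w.getD 0 0).unpair.2 s)
      (SemiDec.and (SemiDec.of_primrecPred (Primrec.nat_lt.comp (by fun_prop) (by fun_prop)))
        (SemiDec.ex (SemiDec.and (SemiDec.near n (Primrec.map_unpair_fst (by fun_prop))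
          (by fun_prop)) (hS.comp₃ (by fun_prop) (by fun_prop) (by fun_prop)))))
    refine ⟨M, ?_⟩
    rintro p ⟨x, k⟩ ⟨hp, hk⟩
    replace hp : cauchyNaming n (fun i => (p i).unpair.1) x := hp
    replace hk : (p 0).unpair.2 = k := hk
    obtain ⟨q, hq, h1, h2⟩ := hM p
    refine ⟨q, hq, ?_, fun b hb => ?_⟩
    · rintro _ ⟨i, rfl⟩
      rcases h1 i with h | ⟨K, hK0, e, he, he'⟩
      -- The filler `0` codes the rational `0`, a lower bound because `g` is nonnegative.
      · simpa [h, ratCode_zero] using hg (x, k)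
      · rw [length_initSeg] at hK0
        rw [initSeg_map p fun i => i.unpair.1] at he
        rw [getD_initSeg hK0, hk] at he'
        exact hsound x e k _ he' (he.mem hp)
    · by_contra! hlt
      obtain ⟨r, hr, hr'⟩ := EReal.exists_rat_btwn_of_lt hlt
      obtain ⟨s, rfl⟩ := ratCode_surjective r
      obtain ⟨t, hst, ht⟩ := hcomplete x k s hr'
      obtain ⟨e, he, he'⟩ := (ht.and eventually_mem_ratBall).exists
      obtain ⟨K, hK⟩ := hp.exists_near he'
      have hK0 : 0 < K := by
        obtain ⟨i, hi, -⟩ := hK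
        rw [length_initSeg] at hi
        lia
      obtain ⟨i, hi⟩ := h2 K t ⟨by rwa [length_initSeg], e,
        by rwa [initSeg_map p fun i => i.unpair.1], by rwa [getD_initSeg hK0, hk]⟩
      have h3 : (((ratCode t : ℚ) : ℝ) : EReal) ≤ b := hb ⟨i, by beta_reduce; rw [hi]⟩
      have h4 : (((ratCode s : ℚ) : ℝ) : EReal) ≤ ((ratCode t : ℚ) : ℝ) := by exact_mod_cast hst
      exact (hr.trans_le (h4.trans h3)).false

end characterizations

/-! ### R.e. open sets and images of balls -/

theorem eventually_ratBall_subset {d : ℕ} {x : Euc d} {W : Set (Euc d)} (hW : IsOpen W)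
    (hx : x ∈ W) : ∀ᶠ e in ballsAt d x, ratBall d e ⊆ W := by
  obtain ⟨ε, hε, h⟩ := Metric.isOpen_iff.1 hW x hx
  filter_upwards [eventually_rad_lt (x := x) (half_pos hε), eventually_mem_ratBall] with e he he'
  intro y hy
  refine h ?_
  rw [mem_ratBall] at he' hy
  rw [Metric.mem_ball]
  have := dist_triangle_right y x (ctr d e)
  linarith

/-- Formal inclusion in a listed ball is a semidecidable substitute for inclusion in `X`, and it
holds for all small balls around a point of `X`. -/
theorem IsREOpen.exists_semiDec {n : ℕ} {X : Set (Euc n)} (hX : IsREOpen X) :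
    ∃ Q : ℕ → Prop, SemiDec Q ∧ (∀ e, Q e → ratBall n e ⊆ X) ∧
      ∀ x ∈ X, ∀ᶠ e in ballsAt n x, Q e := by
  obtain ⟨p, hp, hpX⟩ := hX
  refine ⟨fun e => ∃ j b, p j = b ∧ Inside n e b 0, ?_, ?_, ?_⟩
  · exact SemiDec.ex (SemiDec.ex (SemiDec.and
      ((SemiDec.graph hp).comp₂ (P := fun j b => p j = b) (by fun_prop) (by fun_prop))
      (SemiDec.inside n (by fun_prop) (by fun_prop) PrimrecReal.zero)))
  · rintro e ⟨j, _, rfl, h⟩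
    rw [show X = _ from hpX]
    exact h.subset.trans (Set.subset_iUnion_of_subset j subset_rfl)
  · intro x hx
    rw [show X = _ from hpX] at hx
    obtain ⟨j, hj⟩ := Set.mem_iUnion.1 hx
    filter_upwards [eventually_inside hj] with e he using ⟨j, _, rfl, he⟩

theorem IsREOpen.isOpen {n : ℕ} {X : Set (Euc n)} (hX : IsREOpen X) : IsOpen X := by
  obtain ⟨p, -, hpX⟩ := hX
  rw [show X = _ from hpX]
  exact isOpen_iUnion fun j => isOpen_ratBall n (p j)

section characterizations

variable {n m : ℕ} {X : Set (Euc n)} {f : X → Euc m}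

theorem imageOn_mono {U V : Set (Euc n)} (h : U ⊆ V) : imageOn f U ⊆ imageOn f V :=
  Set.image_mono (Set.preimage_mono h)

theorem mem_imageOn_of_mem {U : Set (Euc n)} {x : X} (h : (x : Euc n) ∈ U) : f x ∈ imageOn f U :=
  ⟨x, h, rfl⟩

/-- A function is effectively open iff the images of balls are enumerable as open sets, uniformly in
the ball. -/
theorem isEffectivelyOpen_iff (hX : IsREOpen X) : IsEffectivelyOpen f ↔
    ∃ T : ℕ → ℕ → Prop, (SemiDec fun z : ℕ × ℕ => T z.1 z.2) ∧
      (∀ e d, T e d → ratBall m d ⊆ imageOn f (ratBall n e)) ∧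
      ∀ (x : X) e, (x : Euc n) ∈ ratBall n e → ∃ d, f x ∈ ratBall m d ∧ T e d := by
  classical
  rw [IsEffectivelyOpen, isComputableMap_iff]
  constructor
  · rintro ⟨-, M, hM⟩
    obtain ⟨Q, hQ, hQX, hXQ⟩ := hX.exists_semiDec
    -- A sequence that lists exactly the codes in `C e` is a name of `ratBall n e ∩ X`, and every
    -- word over `C e` extends to such a sequence. The code `0` of the empty ball serves as filler.
    let C : ℕ → ℕ → Prop := fun e c => c = 0 ∨ (Inside n c e 0 ∧ Q c)
    have hC : SemiDec fun z : ((ℕ × ℕ) × List ℕ) × ℕ => C z.1.1.1 (z.1.2.getD z.2 0) :=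
      SemiDec.or (SemiDec.of_primrecPred (Primrec.eq.comp (by fun_prop) (by fun_prop)))
        (SemiDec.and (SemiDec.inside n (by fun_prop) (by fun_prop) PrimrecReal.zero)
          (hQ.comp (by fun_prop)))
    have hname : ∀ e p, (∀ i, C e (p i)) → (∀ c, C e c → ∃ i, p i = c) →
        openNaming n p (ratBall n e ∩ X) := by
      intro e p hp hp'
      ext y
      rw [Set.mem_iUnion]
      constructor
      · rintro ⟨hy, hyX⟩
        obtain ⟨c, ⟨hc, hcQ⟩, hyc⟩ := (((eventually_inside hy).and (hXQ y hyX)).and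
          eventually_mem_ratBall).exists
        obtain ⟨i, rfl⟩ := hp' c (Or.inr ⟨hc, hcQ⟩)
        exact ⟨i, hyc⟩
      · rintro ⟨i, hi⟩
        rcases hp i with h | ⟨h, h'⟩
        · simp [h, ratBall_zero] at hi
        · exact ⟨h.subset hi, hQX _ h' hi⟩
    have hMC : ∀ e p, (∀ i, C e (p i)) → (∀ c, C e c → ∃ i, p i = c) →
        ∃ q, M.Produces p q ∧ imageOn f (ratBall n e) = ⋃ j, ratBall m (q j) := by
      intro e p hp hp'
      obtain ⟨q, hq, hq'⟩ := hM p ⟨ratBall n e ∩ X,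
        (isOpen_ratBall n e).inter hX.isOpen, Set.inter_subset_right⟩ (hname e p hp hp')
      refine ⟨q, hq, Eq.trans ?_ hq'⟩
      simp [imageOn]
    let g : ℕ → ℕ → ℕ := fun e c => if C e c then c else 0
    have hg : ∀ e c, C e (g e c) := by
      intro e c
      by_cases h : C e c
      · simp only [g, h, if_true]
      · simp only [g, h, if_false]
        exact Or.inl rfl
    have hg' : ∀ e c, C e c → g e c = c := fun e c h => if_pos h
    refine ⟨fun e d => ∃ w : List ℕ, (∀ i < w.length, C e (w.getD i 0)) ∧
      ∃ i : ℕ, (M.out w)[i]? = some d, ?_, ?_, ?_⟩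
    · exact SemiDec.ex_list (SemiDec.and (SemiDec.forall_lt hC (by fun_prop))
        (SemiDec.ex (SemiDec.out M (by fun_prop) (by fun_prop) (by fun_prop))))
    · rintro e d ⟨w, hw, i, ho⟩
      -- The shift by `w.length` lets the list of all admissible codes start right after `w`, so
      -- that none is lost. Computability of this continuation is not needed.
      obtain ⟨q, hq, hq'⟩ := hMC e (extendWord w fun j => g e (j - w.length)) (fun j => by
        rcases lt_or_ge j w.length with hj | hj
        · rw [extendWord_of_lt _ _ hj 0]
          exact hw j hj
        · rw [extendWord_of_le _ _ hj]
          exact hg _ _) (fun c hc => ⟨w.length + c, by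
            rw [extendWord_of_le _ _ (by lia), Nat.add_sub_cancel_left, hg' e c hc]⟩)
      rw [← initSeg_extendWord w fun j => g e (j - w.length)] at ho
      rw [hq', hq.eq ho]
      exact Set.subset_iUnion_of_subset i subset_rfl
    · intro x e hx
      obtain ⟨q, hq, hq'⟩ := hMC e (g e) (hg e) fun c hc => ⟨c, hg' e c hc⟩
      have hfx : f x ∈ imageOn f (ratBall n e) := mem_imageOn_of_mem hx
      rw [hq'] at hfx
      obtain ⟨i, hi⟩ := Set.mem_iUnion.1 hfx
      obtain ⟨k, hk⟩ := hq i
      refine ⟨q i, hi, initSeg (g e) k, fun j hj => ?_, i, hk⟩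
      rw [length_initSeg] at hj
      rw [getD_initSeg hj]
      exact hg e j
  · rintro ⟨T, hT, hsound, hcomplete⟩
    refine ⟨?_, ?_⟩
    · rintro _ ⟨W, hW, rfl⟩
      rw [isOpen_iff_forall_mem_open]
      rintro _ ⟨x, hx, rfl⟩
      obtain ⟨e, he, he'⟩ := ((eventually_ratBall_subset hW hx).and eventually_mem_ratBall).exists
      obtain ⟨d, hd, hd'⟩ := hcomplete x e he'
      exact ⟨ratBall m d, (hsound e d hd').trans (imageOn_mono he), isOpen_ratBall m d, hd⟩
    · obtain ⟨M, hM⟩ := Type2Machine.exists_enumerating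
        (E := fun w d => ∃ i, i < w.length ∧ T (w.getD i 0) d)
        (SemiDec.ex (SemiDec.and (SemiDec.of_primrecPred
          (Primrec.nat_lt.comp (by fun_prop) (by fun_prop))) (hT.comp₂ (by fun_prop)
            (by fun_prop))))
      refine ⟨M, ?_⟩
      rintro p ⟨U, _, hUX⟩ hp
      replace hp : U = _ := hp
      obtain ⟨q, hq, h1, h2⟩ := hM p
      refine ⟨q, hq, Set.Subset.antisymm ?_ (Set.iUnion_subset fun i => ?_)⟩
      · rintro _ ⟨x, hx, rfl⟩
        replace hx : (x : Euc n) ∈ U := hx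
        rw [hp] at hx
        obtain ⟨i, hi⟩ := Set.mem_iUnion.1 hx
        obtain ⟨d, hd, hd'⟩ := hcomplete x _ hi
        obtain ⟨j, rfl⟩ := h2 (i + 1) d ⟨i, by simp [length_initSeg],
          by rwa [getD_initSeg i.lt_succ_self]⟩
        exact Set.mem_iUnion.2 ⟨j, hd⟩
      · rcases h1 i with h | ⟨k, j, hj, h⟩
        · simp [h, ratBall_zero]
        · rw [length_initSeg] at hj
          rw [getD_initSeg hj] at h
          refine (hsound _ _ h).trans (imageOn_mono ?_)
          refine Set.Subset.trans ?_ hp.superset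
          exact Set.subset_iUnion_of_subset j subset_rfl

end characterizations

/-! ### Formal distance bounds -/

theorem SemiDec.mem_ratBall {d : ℕ} {y : ℕ → Euc d}
    (h : SemiDec fun z : ℕ × ℕ => y z.1 ∈ ratBall d z.2) {α : Type} [Primcodable α] {u v : α → ℕ}
    (hu : Primrec u) (hv : Primrec v) : SemiDec fun a => y (u a) ∈ ratBall d (v a) :=
  h.comp₂ (P := fun j e => y j ∈ ratBall d e) hu hv

/-- The points of the balls `e` and `e'` have distance less than `2⁻ᵏ`. -/
def Within (d e e' k : ℕ) : Prop := dist (ctr d e) (ctr d e') < 2⁻¹ ^ k - rad e - rad e'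

theorem SemiDec.within (d : ℕ) {α : Type} [Primcodable α] {u v k : α → ℕ} (hu : Primrec u)
    (hv : Primrec v) (hk : Primrec k) : SemiDec fun a => Within d (u a) (v a) (k a) :=
  SemiDec.dist_lt d (u := fun a => (u a).unpair.1) (v := fun a => (v a).unpair.1) (by fun_prop)
    (by fun_prop) (((PrimrecReal.half_pow hk).sub (PrimrecReal.rad hu)).sub (PrimrecReal.rad hv))

theorem Within.dist_lt {d e e' k : ℕ} (h : Within d e e' k) {x y : Euc d} (hx : x ∈ ratBall d e)
    (hy : y ∈ ratBall d e') : dist y x < 2⁻¹ ^ k := by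
  rw [mem_ratBall] at hx hy
  rw [Within] at h
  have h1 := dist_triangle4_right y x (ctr d e') (ctr d e)
  rw [dist_comm (ctr d e') (ctr d e)] at h1
  linarith

/-- The quantifiers are nested so that `e'` can be fixed first while `e` still shrinks to `x`. -/
theorem eventually_within {d k : ℕ} {x y : Euc d} (h : dist y x < 2⁻¹ ^ k) :
    ∀ᶠ e' in ballsAt d y, ∀ᶠ e in ballsAt d x, Within d e e' k := by
  filter_upwards [eventually_dist_lt (x := y) (y := x) (r := 2⁻¹ ^ k) (t := 0) (by simpa using h)]
    with e' he'
  exact eventually_dist_lt (by rw [dist_comm]; linarith)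

/-! ## Moduli -/

section moduli

variable {n m : ℕ} {X : Set (Euc n)} {f : X → Euc m}

theorem IsComputableMap.of_restrict {A B : Type} {δ : Naming A} {γ : Naming B} {Y : Set B} {g : A → Y}
    (h : IsComputableMap δ (γ.restrict Y) g) : IsComputableMap δ γ fun a => (g a : B) := by
  rw [isComputableMap_iff] at *
  exact h

theorem IsComputableFun.comp_sequence (hf : IsComputableFun f) {xs : ℕ → X}
    (hxs : IsComputableMap natNaming ((cauchyNaming n).restrict X) xs) :
    IsComputableMap natNaming (cauchyNaming m) fun j => f (xs j) := by
  obtain ⟨S, hS, hsound, hcomplete⟩ := isComputableFun_iff.1 hf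
  have hA : SemiDec fun z : ℕ × ℕ => (xs z.1 : Euc n) ∈ ratBall n z.2 :=
    (isComputableMap_nat_iff (y := fun j => (xs j : Euc n))).1 hxs.of_restrict
  refine isComputableMap_nat_iff.2 (SemiDec.of_iff (SemiDec.ex (P := fun (z : ℕ × ℕ) e =>
    (xs z.1 : Euc n) ∈ ratBall n e ∧ S e z.2) (SemiDec.and
      (hA.mem_ratBall (y := fun j => (xs j : Euc n)) (by fun_prop) (by fun_prop))
      (hS.comp₂ (by fun_prop) (by fun_prop)))) fun z => ⟨fun h => ?_, ?_⟩)
  · obtain ⟨e, he, he'⟩ := ((hcomplete _ _ h).and eventually_mem_ratBall).exists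
    exact ⟨e, he', he⟩
  · rintro ⟨e, he, he'⟩
    exact hsound _ _ _ he' he

/-- If `f` maps `e'` into a ball `d` of radius below `2⁻¹ ^ (k + 1)`, then the values on `e'` differ
by less than `2⁻¹ ^ k`, and the depth of a point in `e'` provides `l`. -/
theorem IsComputableFun.exists_modulusOfContinuity (hf : IsComputableFun f) :
    ∃ moc : X × ℕ → Set ℕ, IsComputableModulus moc ∧ IsModulusOfContinuity f moc := by
  obtain ⟨S, hS, hsound, hcomplete⟩ := isComputableFun_iff.1 hf
  refine exists_isComputableModulus_iff.2 ⟨fun e k l => ∃ d e', rad d < 2⁻¹ ^ (k + 1) ∧ S e' d ∧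
    Inside n e e' (2⁻¹ ^ l), ?_, ?_, ?_⟩
  · exact SemiDec.ex (SemiDec.ex (SemiDec.and (SemiDec.real_lt (PrimrecReal.rad (by fun_prop))
      (PrimrecReal.half_pow (by fun_prop))) (SemiDec.and (hS.comp₂ (by fun_prop) (by fun_prop))
        (SemiDec.inside n (by fun_prop) (by fun_prop) (PrimrecReal.half_pow (by fun_prop))))))
  · rintro x e k l ⟨d, e', hd, hS', he⟩ hx
    rintro _ ⟨y, hy, rfl⟩
    have h1 := mem_ratBall.1 (hsound x e' d hS' (he.mem hx (by simp)))
    have h2 := mem_ratBall.1 (hsound y e' d hS' (he.mem hx (le_of_lt hy)))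
    have h3 := dist_triangle_right (f y) (f x) (ctr m d)
    rw [Metric.mem_ball]
    rw [pow_succ] at hd
    linarith
  · intro x k
    obtain ⟨d, hd, hd'⟩ := ((eventually_rad_lt (x := f x) (r := 2⁻¹ ^ (k + 1)) (by positivity)).and
      eventually_mem_ratBall).exists
    obtain ⟨e', he', hx⟩ := ((hcomplete x d hd').and eventually_mem_ratBall).exists
    obtain ⟨l, hl⟩ := exists_eventually_inside hx
    refine ⟨l, ?_⟩
    filter_upwards [hl] with e he using ⟨d, e', hd, he', he⟩

/-- By density some `x_j` is as close to `x` as the modulus asks. The ball `d` is then recognized as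
containing `f x` because `f (x_j)` lies in it with margin `2⁻¹ ^ k`. -/
theorem isComputableFun_of_modulusOfContinuity {xs : ℕ → X}
    (hxs : IsComputableMap natNaming ((cauchyNaming n).restrict X) xs) (hd : DenseRange xs)
    (hf : IsComputableMap natNaming (cauchyNaming m) fun j => f (xs j))
    (hmoc : ∃ moc : X × ℕ → Set ℕ, IsComputableModulus moc ∧ IsModulusOfContinuity f moc) :
    IsComputableFun f := by
  obtain ⟨S, hS, hsound, hcomplete⟩ := exists_isComputableModulus_iff.1 hmoc
  have hA : SemiDec fun z : ℕ × ℕ => (xs z.1 : Euc n) ∈ ratBall n z.2 :=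
    (isComputableMap_nat_iff (y := fun j => (xs j : Euc n))).1 hxs.of_restrict
  have hB := isComputableMap_nat_iff.1 hf
  refine isComputableFun_iff.2 ⟨fun e d => ∃ k l j e' d', S e k l ∧ (xs j : Euc n) ∈ ratBall n e' ∧
    Within n e e' l ∧ f (xs j) ∈ ratBall m d' ∧ Inside m d' d (2⁻¹ ^ k), ?_, ?_, ?_⟩
  · exact SemiDec.ex (SemiDec.ex (SemiDec.ex (SemiDec.ex (SemiDec.ex (SemiDec.and
      (hS.comp₃ (by fun_prop) (by fun_prop) (by fun_prop)) (SemiDec.and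
      (hA.mem_ratBall (y := fun j => (xs j : Euc n)) (by fun_prop) (by fun_prop))
      (SemiDec.and (SemiDec.within n (by fun_prop) (by fun_prop) (by fun_prop)) (SemiDec.and
      (hB.mem_ratBall (y := fun j => f (xs j)) (by fun_prop) (by fun_prop))
      (SemiDec.inside m (by fun_prop) (by fun_prop) (PrimrecReal.half_pow (by fun_prop))))))))))) 
  · rintro x e d ⟨k, l, j, e', d', hS', hj, he, hfj, hd⟩ hx
    have h1 : dist (f (xs j)) (f x) < 2⁻¹ ^ k :=
      hsound x e k l hS' hx (mem_imageOn_of_mem (he.dist_lt hx hj))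
    exact hd.mem hfj (by rw [dist_comm]; exact h1.le)
  · intro x d hx
    rw [mem_ratBall] at hx
    -- Room for `2 * 2⁻ᵏ`: one for the step from `f x` to `f (xs j)`, one for the required margin.
    obtain ⟨k, hk⟩ := exists_half_pow_lt (half_pos (sub_pos.2 hx))
    obtain ⟨l, hl⟩ := hcomplete x k
    obtain ⟨e₀, he₀, he₀'⟩ := (hl.and eventually_mem_ratBall).exists
    obtain ⟨j, hj⟩ := hd.exists_dist_lt x (ε := 2⁻¹ ^ l) (by positivity)
    rw [dist_comm] at hj
    replace hj : dist (xs j : Euc n) x < 2⁻¹ ^ l := hj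
    have h1 : dist (f (xs j)) (f x) < 2⁻¹ ^ k :=
      hsound x e₀ k l he₀ he₀' (mem_imageOn_of_mem hj)
    have h2 := dist_triangle (f (xs j)) (f x) (ctr m d)
    obtain ⟨d', hd', hd''⟩ := ((eventually_dist_lt (x := f (xs j)) (y := ctr m d) (r := rad d)
      (t := 2⁻¹ ^ k) (by linarith)).and eventually_mem_ratBall).exists
    obtain ⟨e', he', he''⟩ := ((eventually_within hj).and eventually_mem_ratBall).exists
    filter_upwards [hl, he'] with e he h using ⟨k, l, j, e', d', he, he'', h, hd'', hd'⟩

/-- A ball `e'` that contains `x` and is formally within `2⁻¹ ^ k` of it has an image containing a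
ball `d` around `f x`; the depth of `f x` in `d` is confirmed by computing `f x` approximately. -/
theorem exists_modulusOfOpenness_of_isEffectivelyOpen (hX : IsREOpen X) (hf : IsComputableFun f)
    (ho : IsEffectivelyOpen f) :
    ∃ moo : X × ℕ → Set ℕ, IsComputableModulus moo ∧ IsModulusOfOpenness f moo := by
  obtain ⟨S, hS, hSs, hSc⟩ := isComputableFun_iff.1 hf
  obtain ⟨T, hT, hTs, hTc⟩ := (isEffectivelyOpen_iff hX).1 ho
  refine exists_isComputableModulus_iff.2 ⟨fun e k l => ∃ e' d d', Within n e e' k ∧ T e' d ∧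
    Inside m d' d (2⁻¹ ^ l) ∧ S e d', ?_, ?_, ?_⟩
  · exact SemiDec.ex (SemiDec.ex (SemiDec.ex (SemiDec.and (SemiDec.within n (by fun_prop)
      (by fun_prop) (by fun_prop)) (SemiDec.and (hT.comp₂ (by fun_prop) (by fun_prop))
      (SemiDec.and (SemiDec.inside m (by fun_prop) (by fun_prop)
        (PrimrecReal.half_pow (by fun_prop))) (hS.comp₂ (by fun_prop) (by fun_prop)))))))
  · rintro x e k l ⟨e', d, d', he, hd, hd', hS'⟩ hx y hy
    have h1 := hTs e' d hd (hd'.mem (hSs x e d' hS' hx) (le_of_lt hy))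
    exact imageOn_mono (fun z hz => he.dist_lt hx hz) h1
  · intro x k
    obtain ⟨e', he', hx⟩ := ((eventually_within (x := (x : Euc n)) (y := x) (k := k)
      (by simp)).and eventually_mem_ratBall).exists
    obtain ⟨d, hd, hd'⟩ := hTc x e' hx
    obtain ⟨l, hl⟩ := exists_eventually_inside hd
    obtain ⟨d', h, h'⟩ := (hl.and eventually_mem_ratBall).exists
    refine ⟨l, ?_⟩
    filter_upwards [he', hSc x d' h'] with e h1 h2 using ⟨e', d, d', h1, hd', h, h2⟩

theorem isEffectivelyOpen_of_modulusOfOpenness (hX : IsREOpen X) (hf : IsComputableFun f)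
    (hmoo : ∃ moo : X × ℕ → Set ℕ, IsComputableModulus moo ∧ IsModulusOfOpenness f moo) :
    IsEffectivelyOpen f := by
  obtain ⟨S, hS, hSs, hSc⟩ := isComputableFun_iff.1 hf
  obtain ⟨R, hR, hRs, hRc⟩ := exists_isComputableModulus_iff.1 hmoo
  obtain ⟨Q, hQ, hQs, hQc⟩ := hX.exists_semiDec
  -- The modulus is applied at the center of `e'`. The last two conditions make this center a point
  -- of `X` that lies in `e'`; the bound on `rad d` puts `d` inside the `2⁻¹ ^ l`-ball around its
  -- value.
  refine (isEffectivelyOpen_iff hX).2 ⟨fun e d => ∃ e' k l, R e' k l ∧ S e' d ∧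
    rad d < 2⁻¹ ^ (l + 1) ∧ Inside n e' e (2⁻¹ ^ k) ∧ Q e' ∧ 0 < rad e', ?_, ?_, ?_⟩
  · exact SemiDec.ex (SemiDec.ex (SemiDec.ex (SemiDec.and (hR.comp₃ (by fun_prop) (by fun_prop)
      (by fun_prop)) (SemiDec.and (hS.comp₂ (by fun_prop) (by fun_prop)) (SemiDec.and
      (SemiDec.real_lt (PrimrecReal.rad (by fun_prop)) (PrimrecReal.half_pow (by fun_prop)))
      (SemiDec.and (SemiDec.inside n (by fun_prop) (by fun_prop)
        (PrimrecReal.half_pow (by fun_prop))) (SemiDec.and (hQ.comp (by fun_prop))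
        (SemiDec.real_lt PrimrecReal.zero (PrimrecReal.rad (by fun_prop))))))))))
  · rintro e d ⟨e', k, l, hR', hS', hd, he, hQ', hpos⟩ y hy
    have hc : ctr n e' ∈ ratBall n e' := by
      rw [mem_ratBall, dist_self]
      exact hpos
    have h1 := mem_ratBall.1 (hSs ⟨ctr n e', hQs e' hQ' hc⟩ e' d hS' hc)
    have h2 := dist_triangle_right y (f ⟨ctr n e', hQs e' hQ' hc⟩) (ctr m d)
    have h3 := mem_ratBall.1 hy
    rw [pow_succ] at hd
    exact imageOn_mono (fun z hz => he.mem hc (le_of_lt hz))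
      (hRs ⟨ctr n e', hQs e' hQ' hc⟩ e' k l hR' hc (Metric.mem_ball.2 (by linarith)))
  · intro x e hx
    obtain ⟨k, hk⟩ := exists_eventually_inside hx
    obtain ⟨l, hl⟩ := hRc x k
    obtain ⟨d, hd, hd'⟩ := ((eventually_rad_lt (x := f x) (r := 2⁻¹ ^ (l + 1)) (by positivity)).and
      eventually_mem_ratBall).exists
    obtain ⟨e', he⟩ := (hk.and (hl.and ((hSc x d hd').and
      ((hQc x x.2).and eventually_rad_pos)))).exists
    exact ⟨d, hd', e', k, l, he.2.1, he.2.2.1, hd, he.1, he.2.2.2.1, he.2.2.2.2⟩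

theorem Moo_nonneg (z : X × ℕ) : 0 ≤ Moo f z := by
  refine le_sSup ⟨0, ⟨le_rfl, ?_⟩, by simp⟩
  rw [Metric.closedBall_zero, Set.singleton_subset_iff]
  exact mem_imageOn_of_mem (Metric.mem_ball_self (by positivity))

theorem lt_Moo_iff {z : X × ℕ} {a : EReal} : a < Moo f z ↔ ∃ s : ℝ, a < s ∧ 0 ≤ s ∧
    Metric.closedBall (f z.1) s ⊆ imageOn f (Metric.ball (z.1 : Euc n) ((2 : ℝ)⁻¹ ^ z.2)) := by
  rw [Moo, lt_sSup_iff]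
  simp [and_comm]

/-- The supremum need not be attained. A lower bound strictly above `2⁻¹ ^ l` still provides a
radius `r > 2⁻¹ ^ l` whose closed ball lies in the image. -/
theorem exists_modulusOfOpenness_of_Moo (hpos : ∀ z : X × ℕ, 0 < Moo f z)
    (hf : IsComputableMap (((cauchyNaming n).restrict X).prod natNaming) lowerNaming (Moo f)) :
    ∃ moo : X × ℕ → Set ℕ, IsComputableModulus moo ∧ IsModulusOfOpenness f moo := by
  obtain ⟨S, hS, hSs, hSc⟩ := (isComputableMap_lowerNaming_iff Moo_nonneg).1 hf
  refine exists_isComputableModulus_iff.2 ⟨fun e k l => ∃ s, S e k s ∧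
    (2 : ℝ)⁻¹ ^ l < (ratCode s : ℝ), ?_, ?_, ?_⟩
  · exact SemiDec.ex (SemiDec.and (hS.comp₃ (by fun_prop) (by fun_prop) (by fun_prop))
      (SemiDec.real_lt (PrimrecReal.half_pow (by fun_prop))
        (PrimrecReal.ratCode_apply (by fun_prop))))
  · rintro x e k l ⟨s, hs, hl⟩ hx
    obtain ⟨r, hr, -, hr'⟩ := lt_Moo_iff.1
      ((EReal.coe_lt_coe_iff.2 hl).trans_le (hSs x e k s hs hx))
    exact (Metric.ball_subset_closedBall.trans
      (Metric.closedBall_subset_closedBall (EReal.coe_lt_coe_iff.1 hr).le)).trans hr'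
  · intro x k
    obtain ⟨r, hr, hr'⟩ := EReal.exists_rat_btwn_of_lt (hpos (x, k))
    obtain ⟨s, rfl⟩ := ratCode_surjective r
    obtain ⟨t, hst, ht⟩ := hSc x k s hr'
    have h0 : (0 : ℝ) < (ratCode t : ℝ) :=
      lt_of_lt_of_le (b := (ratCode s : ℝ)) (by exact_mod_cast hr) (by exact_mod_cast hst)
    obtain ⟨l, hl⟩ := exists_half_pow_lt h0
    refine ⟨l, ?_⟩
    filter_upwards [ht] with e he using ⟨t, he, hl⟩

end moduli

/-! ## Covers of closed balls by rational balls -/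

/-- The code of the grid point with coordinates `(vᵢ - A) / (M + 1)`. -/
def gridPoint (v : List ℕ) (A M : ℕ) : ℕ :=
  Encodable.encode (v.map fun i => Nat.pair i (Nat.pair A M))

/-- The mesh of the grid, as a bound for the Euclidean norm. -/
noncomputable def gridMesh (d M : ℕ) : ℝ := ((d + 1 : ℕ) : ℝ) / ((M : ℝ) + 1)

/-- A grid verifies that the balls with codes in `D` cover the closed ball around `c` with
radius `r`: each grid point is too far from the ball or deep in a ball with code in `D`. -/
def GridCovers (d c : ℕ) (r : ℝ) (D : ℕ → Prop) (A M : ℕ) : Prop :=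
  dist (ratVec d c) (ratVec d 0) < (A : ℝ) / ((M : ℝ) + 1) - r ∧
    ∀ v : List ℕ, v.length = d → (∀ i ∈ v, i < 2 * A + 1) →
      r + gridMesh d M < dist (ratVec d (gridPoint v A M)) (ratVec d c) ∨
      ∃ e, D e ∧ dist (ratVec d (gridPoint v A M)) (ctr d e) < rad e - gridMesh d M

section cover

variable {d c : ℕ} {r : ℝ} {D : ℕ → Prop} {A M : ℕ}

theorem Primrec.gridPoint_apply {α : Type} [Primcodable α] {v : α → List ℕ} {A M : α → ℕ}
    (hv : Primrec v) (hA : Primrec A) (hM : Primrec M) :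
    Primrec fun a => gridPoint (v a) (A a) (M a) :=
  Primrec.encode.comp (Primrec.list_map hv
    (show Primrec fun z : α × ℕ => Nat.pair z.2 (Nat.pair (A z.1) (M z.1)) by fun_prop))

/-- Only finitely many grid points are quantified over, and each has a semidecidable condition. The
assumption on `r` is stable under composition because `r` is also used with the grid point as an
additional variable. -/
theorem SemiDec.gridCovers (d : ℕ) {α : Type} [Primcodable α] {c : α → ℕ} {r : α → ℝ}
    {D : α → ℕ → Prop} {A M : α → ℕ} (hc : Primrec c)
    (hr : ∀ {β : Type} [Primcodable β] {u : β → α}, Primrec u → PrimrecReal fun b => r (u b))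
    (hD : SemiDec fun z : α × ℕ => D z.1 z.2) (hA : Primrec A) (hM : Primrec M) :
    SemiDec fun a => GridCovers d (c a) (r a) (D a) (A a) (M a) := by
  have h1 : SemiDec fun a => dist (ratVec d (c a)) (ratVec d 0) <
      (A a : ℝ) / ((M a : ℝ) + 1) - r a :=
    SemiDec.dist_lt d hc (Primrec.const 0) (((PrimrecReal.natCast hA).div_succ hM).sub
      (hr Primrec.id))
  have hg : Primrec fun z : α × List ℕ => gridPoint z.2 (A z.1) (M z.1) :=
    Primrec.gridPoint_apply (by fun_prop) (by fun_prop) (by fun_prop)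
  have hmesh : ∀ {β : Type} [Primcodable β] {u : β → α}, Primrec u →
      PrimrecReal fun b => gridMesh d (M (u b)) := fun hu =>
    (PrimrecReal.natCast (Primrec.const (d + 1))).div_succ (by fun_prop)
  have h2 : SemiDec fun z : α × List ℕ => r z.1 + gridMesh d (M z.1) <
      dist (ratVec d (gridPoint z.2 (A z.1) (M z.1))) (ratVec d (c z.1)) :=
    SemiDec.lt_dist d hg (by fun_prop) ((hr (by fun_prop)).add (hmesh (by fun_prop)))
  have h3 : SemiDec fun z : (α × List ℕ) × ℕ => dist (ratVec d (gridPoint z.1.2 (A z.1.1) (M z.1.1)))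
      (ctr d z.2) < rad z.2 - gridMesh d (M z.1.1) :=
    SemiDec.dist_lt d (v := fun z : (α × List ℕ) × ℕ => z.2.unpair.1) (hg.comp Primrec.fst)
      (by fun_prop) ((PrimrecReal.rad (by fun_prop)).sub (hmesh (by fun_prop)))
  have h4 : SemiDec fun z : (α × List ℕ) × ℕ => D z.1.1 z.2 :=
    hD.comp₂ (by fun_prop) (by fun_prop)
  exact h1.and (SemiDec.forall_words d (h2.or (SemiDec.ex (h4.and h3))) (by fun_prop))

theorem ratVec_gridPoint (d : ℕ) {v : List ℕ} (A M : ℕ) (i : Fin d) (hv : v.length = d) :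
    ratVec d (gridPoint v A M) i = ((v.getD i 0 : ℝ) - A) / ((M : ℝ) + 1) := by
  have hi : (i : ℕ) < v.length := by
    rw [hv]
    exact i.2
  simp [ratVec_apply, gridPoint, hi, ratCode]

theorem exists_gridPoint {y : Euc d} (hy : ‖y‖ < (A : ℝ) / ((M : ℝ) + 1)) :
    ∃ v : List ℕ, v.length = d ∧ (∀ i ∈ v, i < 2 * A + 1) ∧
      dist y (ratVec d (gridPoint v A M)) ≤ gridMesh d M := by
  have hM : (0 : ℝ) < (M : ℝ) + 1 := by positivity
  have hyi : ∀ i, -(A : ℝ) < y i * (M + 1) ∧ y i * (M + 1) < A := by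
    intro i
    have h1 : |y i| < (A : ℝ) / ((M : ℝ) + 1) := (PiLp.norm_apply_le y i).trans_lt hy
    rw [lt_div_iff₀ hM] at h1
    rw [← abs_lt, abs_mul, abs_of_pos hM]
    exact h1
  -- Each coordinate is rounded down to the grid; the shift by `A` makes the index a natural number
  -- below `2 * A + 1`.
  let u : Fin d → ℕ := fun i => ⌊y i * (M + 1) + A⌋₊
  have hu : ∀ i, (u i : ℝ) ≤ y i * (M + 1) + A ∧ y i * (M + 1) + A < u i + 1 := fun i =>
    ⟨Nat.floor_le (by linarith [(hyi i).1]), Nat.lt_floor_add_one _⟩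
  refine ⟨List.ofFn u, List.length_ofFn, ?_, ?_⟩
  · intro j hj
    obtain ⟨i, rfl⟩ := (List.mem_ofFn' u j).1 hj
    have : (u i : ℝ) < ((2 * A + 1 : ℕ) : ℝ) := by
      push_cast
      linarith [(hu i).1, (hyi i).2]
    exact_mod_cast this
  · have h1 : ∀ i, dist (y i) (ratVec d (gridPoint (List.ofFn u) A M) i) ^ 2 ≤
        (1 / ((M : ℝ) + 1)) ^ 2 := by
      intro i
      have h2 : y i - ratVec d (gridPoint (List.ofFn u) A M) i =
          (y i * (M + 1) + A - u i) / (M + 1) := by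
        rw [ratVec_gridPoint d A M i List.length_ofFn]
        simp only [List.getD_eq_getElem?_getD, List.getElem?_ofFn, i.2, dite_true, Fin.eta,
          Option.getD_some]
        field_simp
        ring
      have h3 : 0 ≤ y i - ratVec d (gridPoint (List.ofFn u) A M) i := by
        rw [h2]
        exact div_nonneg (by linarith [(hu i).1]) hM.le
      rw [Real.dist_eq, abs_of_nonneg h3]
      refine pow_le_pow_left₀ h3 ?_ 2
      rw [h2]
      exact div_le_div_of_nonneg_right (by linarith [(hu i).2]) hM.le
    have h4 : dist y (ratVec d (gridPoint (List.ofFn u) A M)) ^ 2 ≤ gridMesh d M ^ 2 := by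
      rw [EuclideanSpace.dist_sq_eq]
      refine (Finset.sum_le_sum fun i _ => h1 i).trans ?_
      rw [Finset.sum_const, Finset.card_univ, Fintype.card_fin, nsmul_eq_mul, gridMesh, div_pow,
        div_pow, ← mul_div_assoc]
      refine div_le_div_of_nonneg_right ?_ (by positivity)
      push_cast
      -- This is `d ≤ (d + 1) ^ 2`: the mesh has `d + 1` in place of `√d` in order to be rational.
      nlinarith [(Nat.cast_nonneg d : (0 : ℝ) ≤ d)]
    exact le_of_sq_le_sq h4 (by unfold gridMesh; positivity)

/-- A grid point at distance at most the mesh from `y` cannot be far from the ball, so it is deep in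
some ball with code in `D`, deep enough for `y` to lie there too. -/
theorem GridCovers.subset (h : GridCovers d c r D A M) {y : Euc d} (hy : dist y (ratVec d c) ≤ r) :
    ∃ e, D e ∧ y ∈ ratBall d e := by
  obtain ⟨hbox, h⟩ := h
  have hy' : ‖y‖ < (A : ℝ) / ((M : ℝ) + 1) := by
    rw [ratVec_zero] at hbox
    rw [← dist_zero_right]
    linarith [dist_triangle y (ratVec d c) 0]
  obtain ⟨v, hv, hvA, hyv⟩ := exists_gridPoint hy'
  rcases h v hv hvA with h | ⟨e, he, h⟩
  · linarith [dist_triangle_left (ratVec d (gridPoint v A M)) (ratVec d c) y]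
  · refine ⟨e, he, ?_⟩
    rw [mem_ratBall]
    linarith [dist_triangle y (ratVec d (gridPoint v A M)) (ctr d e)]

/-- By compactness the covering balls may all be shrunk by the same `2⁻¹ ^ j`, as with a Lebesgue
number; any grid much finer than that detects the cover. -/
theorem exists_gridCovers (hr : 0 ≤ r)
    (h : Metric.closedBall (ratVec d c) r ⊆ ⋃ e ∈ {e | D e}, ratBall d e) :
    ∃ A M, GridCovers d c r D A M := by
  let U : ℕ → Set (Euc d) := fun j => ⋃ e ∈ {e | D e}, Metric.ball (ctr d e) (rad e - 2⁻¹ ^ j)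
  have hU : Metric.closedBall (ratVec d c) r ⊆ ⋃ j, U j := by
    intro y hy
    obtain ⟨e, he, hye⟩ := Set.mem_iUnion₂.1 (h hy)
    obtain ⟨j, hj⟩ := exists_half_pow_lt (sub_pos.2 (mem_ratBall.1 hye))
    exact Set.mem_iUnion.2 ⟨j, Set.mem_iUnion₂.2 ⟨e, he, Metric.mem_ball.2 (by linarith)⟩⟩
  have hmono : Monotone U := by
    intro j k hjk
    refine Set.iUnion₂_mono fun e _ => Metric.ball_subset_ball ?_
    have := pow_le_pow_of_le_one (a := (2 : ℝ)⁻¹) (by norm_num) (by norm_num) hjk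
    linarith
  obtain ⟨j, hj⟩ := (isCompact_closedBall (ratVec d c) r).elim_directed_cover U
    (fun j => isOpen_biUnion fun _ _ => Metric.isOpen_ball) hU hmono.directed_le
  -- The mesh is spent twice: between the grid point and a point of the closed ball, and as the
  -- margin in `GridCovers`.
  obtain ⟨M, hM⟩ : ∃ M : ℕ, gridMesh d M < 2⁻¹ ^ j / 2 := by
    have h1 : Tendsto (fun M : ℕ => gridMesh d M) atTop (𝓝 0) :=
      tendsto_const_nhds.div_atTop (tendsto_natCast_atTop_atTop.atTop_add tendsto_const_nhds)
    exact (h1.eventually_lt_const (by positivity)).exists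
  obtain ⟨A, hA⟩ := exists_nat_gt ((dist (ratVec d c) (ratVec d 0) + r) * ((M : ℝ) + 1))
  have hmesh : 0 ≤ gridMesh d M := by unfold gridMesh; positivity
  refine ⟨A, M, ?_, fun v hv hvA => ?_⟩
  · rw [lt_sub_iff_add_lt, lt_div_iff₀ (by positivity)]
    exact hA
  · rw [or_iff_not_imp_left, not_lt]
    intro hle
    obtain ⟨y, hy, hy'⟩ := exists_dist_le_le hmesh hr hle
    obtain ⟨e, he, hye⟩ := Set.mem_iUnion₂.1 (hj (Metric.mem_closedBall.2 hy'))
    refine ⟨e, he, ?_⟩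
    rw [Metric.mem_ball] at hye
    linarith [dist_triangle (ratVec d (gridPoint v A M)) y (ctr d e)]

theorem finite_words (d K : ℕ) : {v : List ℕ | v.length = d ∧ ∀ i ∈ v, i < K}.Finite := by
  refine ((List.finite_length_eq (Fin K) d).image (List.map Fin.val)).subset ?_
  rintro v ⟨hv, hvK⟩
  refine ⟨v.pmap Fin.mk hvK, by simpa using hv, ?_⟩
  simp [List.map_pmap]

/-- A grid needs one ball per grid point, so only finitely many members of `D` are used and their
conditions hold simultaneously. -/
theorem GridCovers.eventually {ι : Type*} {l : Filter ι} {E : ι → ℕ → Prop}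
    (h : GridCovers d c r D A M) (hE : ∀ e, D e → ∀ᶠ a in l, E a e) :
    ∀ᶠ a in l, GridCovers d c r (E a) A M := by
  have h1 : ∀ᶠ a in l, ∀ v ∈ {v : List ℕ | v.length = d ∧ ∀ i ∈ v, i < 2 * A + 1},
      r + gridMesh d M < dist (ratVec d (gridPoint v A M)) (ratVec d c) ∨
      ∃ e, E a e ∧ dist (ratVec d (gridPoint v A M)) (ctr d e) < rad e - gridMesh d M := by
    refine (eventually_all_finite (finite_words d (2 * A + 1))).2 fun v hv => ?_
    rcases h.2 v hv.1 hv.2 with hfar | ⟨e, he, hnear⟩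
    · exact Eventually.of_forall fun _ => Or.inl hfar
    · filter_upwards [hE e he] with a ha using Or.inr ⟨e, ha, hnear⟩
  filter_upwards [h1] with a ha using ⟨h.1, fun v hv hv' => ha v ⟨hv, hv'⟩⟩

end cover

/-! ### Lower computability of the modulus of openness -/

section moduli

variable {n m : ℕ} {X : Set (Euc n)} {f : X → Euc m}

theorem Moo_pos_of_isEffectivelyOpen (hX : IsREOpen X) (hf : IsComputableFun f)
    (ho : IsEffectivelyOpen f) (z : X × ℕ) : 0 < Moo f z := by
  obtain ⟨moo, -, hmoo⟩ := exists_modulusOfOpenness_of_isEffectivelyOpen hX hf ho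
  obtain ⟨⟨l, hl⟩, h⟩ := hmoo z.1 z.2
  refine lt_Moo_iff.2 ⟨2⁻¹ ^ (l + 1), EReal.coe_pos.2 (by positivity), by positivity,
    (Metric.closedBall_subset_ball ?_).trans (h l hl)⟩
  rw [pow_succ]
  linarith [pow_pos (a := (2 : ℝ)⁻¹) (by norm_num) l]

theorem isComputableMap_Moo (hX : IsREOpen X) (hf : IsComputableFun f)
    (ho : IsEffectivelyOpen f) :
    IsComputableMap (((cauchyNaming n).restrict X).prod natNaming) lowerNaming (Moo f) := by
  obtain ⟨S, hS, hSs, hSc⟩ := isComputableFun_iff.1 hf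
  obtain ⟨T, hT, hTs, hTc⟩ := (isEffectivelyOpen_iff hX).1 ho
  -- Such balls `d` lie in the image of the `2⁻ᵏ`-ball around every point of `X` in `e`. As `f x` is
  -- known only up to a ball `b`, the closed ball to be covered is enlarged by `rad b`.
  let D : ℕ → ℕ → ℕ → Prop := fun e k d => ∃ e', Within n e e' k ∧ T e' d
  refine (isComputableMap_lowerNaming_iff Moo_nonneg).2 ⟨fun e k s => ∃ b A M, S e b ∧
    GridCovers m b.unpair.1 (rad b + (ratCode s : ℝ)) (D e k) A M, ?_, ?_, ?_⟩
  · have h1 : SemiDec fun z : (((ℕ × ℕ × ℕ) × ℕ) × ℕ) × ℕ => S z.1.1.1.1 z.1.1.2 :=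
      hS.comp₂ (by fun_prop) (by fun_prop)
    have h2 : SemiDec fun z : ((((ℕ × ℕ × ℕ) × ℕ) × ℕ) × ℕ) × ℕ =>
        D z.1.1.1.1.1 z.1.1.1.1.2.1 z.2 :=
      SemiDec.ex (SemiDec.and (SemiDec.within n (by fun_prop) (by fun_prop) (by fun_prop))
        (hT.comp₂ (by fun_prop) (by fun_prop)))
    have h3 : SemiDec fun z : (((ℕ × ℕ × ℕ) × ℕ) × ℕ) × ℕ => GridCovers m z.1.1.2.unpair.1
        (rad z.1.1.2 + (ratCode z.1.1.1.2.2 : ℝ)) (D z.1.1.1.1 z.1.1.1.2.1) z.1.2 z.2 :=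
      SemiDec.gridCovers m (by fun_prop) (fun hu => (PrimrecReal.rad (by fun_prop)).add
        (PrimrecReal.ratCode_apply (by fun_prop))) h2 (by fun_prop) (by fun_prop)
    exact SemiDec.ex (SemiDec.ex (SemiDec.ex (h1.and h3)))
  · rintro x e k s ⟨b, A, M, hb, hcov⟩ hx
    rcases lt_or_ge (ratCode s : ℝ) 0 with hs | hs
    · exact le_trans (by exact_mod_cast hs.le) (Moo_nonneg (x, k))
    refine le_sSup ⟨_, ⟨hs, fun y hy => ?_⟩, rfl⟩
    have hfx := mem_ratBall.1 (hSs x e b hb hx)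
    rw [Metric.mem_closedBall] at hy
    obtain ⟨d, ⟨e', he', hd⟩, hyd⟩ := hcov.subset (y := y) (by
      change dist y (ctr m b) ≤ _
      linarith [dist_triangle y (f x) (ctr m b)])
    exact imageOn_mono (fun z hz => he'.dist_lt hx hz) (hTs e' d hd hyd)
  · intro x k s hs
    -- Compactness is applied with a nonnegative radius, so a negative `s` is replaced by `0`, which
    -- is still strictly below `Moo`.
    obtain ⟨t, hst, ht0, ht⟩ : ∃ t, ratCode s ≤ ratCode t ∧ 0 ≤ ratCode t ∧
        (((ratCode t : ℚ) : ℝ) : EReal) < Moo f (x, k) := by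
      rcases le_total 0 (ratCode s) with h | h
      · exact ⟨s, le_rfl, h, hs⟩
      · exact ⟨0, by rwa [ratCode_zero], ratCode_zero.ge, by
          simpa [ratCode_zero] using Moo_pos_of_isEffectivelyOpen hX hf ho (x, k)⟩
    refine ⟨t, hst, ?_⟩
    obtain ⟨r, htr, -, hr⟩ := lt_Moo_iff.1 ht
    rw [EReal.coe_lt_coe_iff] at htr
    -- With `2 * rad b < r - t`, the enlarged ball around the center of `b` stays in the closed ball
    -- of radius `r` around `f x`, hence in the image.
    obtain ⟨b, hb, hbx⟩ := ((eventually_rad_lt (x := f x) (half_pos (sub_pos.2 htr))).and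
      eventually_mem_ratBall).exists
    -- The cover is first taken among the balls that are found for all small `e`; the finite grid
    -- then makes it work for one and the same `e`.
    let D' : ℕ → Prop := fun d => ∀ᶠ e in ballsAt n x, D e k d
    have ht0' : (0 : ℝ) ≤ (ratCode t : ℝ) := by exact_mod_cast ht0
    have hrad : 0 < rad b := dist_nonneg.trans_lt (mem_ratBall.1 hbx)
    obtain ⟨A, M, hcov⟩ := exists_gridCovers (d := m) (c := b.unpair.1)
      (r := rad b + (ratCode t : ℝ)) (D := D') (by linarith) (by
        intro y hy
        change dist y (ctr m b) ≤ _ at hy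
        have hbx' := mem_ratBall.1 hbx
        have hyr : dist y (f x) ≤ r := by linarith [dist_triangle_right y (f x) (ctr m b)]
        obtain ⟨z, hz, rfl⟩ := hr hyr
        obtain ⟨e', he', hze⟩ := ((eventually_within (Metric.mem_ball.1 hz)).and
          eventually_mem_ratBall).exists
        obtain ⟨d, hd, hd'⟩ := hTc z e' hze
        refine Set.mem_iUnion₂.2 ⟨d, ?_, hd⟩
        filter_upwards [he'] with e he using ⟨e', he, hd'⟩)
    filter_upwards [hSc x b hbx, hcov.eventually (E := fun e => D e k) fun d hd => hd] with e h1 h2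
    exact ⟨b, A, M, h1, h2⟩

end moduli

theorem theorem2 (n m : ℕ) (X : Set (Euc n)) (hX : IsREOpen X) :
    -- (a ii)
    (∀ xs : ℕ → X, IsComputableMap natNaming ((cauchyNaming n).restrict X) xs → DenseRange xs →
      ∀ f : X → Euc m,
        IsComputableFun f ↔
          (IsComputableMap natNaming (cauchyNaming m) (fun j => f (xs j)) ∧
            ∃ moc : X × ℕ → Set ℕ, IsComputableModulus moc ∧ IsModulusOfContinuity f moc)) ∧
    -- (b i)
    (∀ f : X → Euc m, IsComputableFun f →
      (IsEffectivelyOpen f ↔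
        ((∀ z : X × ℕ, 0 < Moo f z) ∧
          IsComputableMap (((cauchyNaming n).restrict X).prod natNaming) lowerNaming (Moo f)))) ∧
    -- (b ii)
    (∀ f : X → Euc m, IsComputableFun f →
      (IsEffectivelyOpen f ↔
        ∃ moo : X × ℕ → Set ℕ, IsComputableModulus moo ∧ IsModulusOfOpenness f moo)) := by
  refine ⟨fun xs hxs hd f => ⟨fun hf => ⟨hf.comp_sequence hxs, hf.exists_modulusOfContinuity⟩,
    fun h => isComputableFun_of_modulusOfContinuity hxs hd h.1 h.2⟩, fun f hf => ⟨fun ho =>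
      ⟨Moo_pos_of_isEffectivelyOpen hX hf ho, isComputableMap_Moo hX hf ho⟩, fun h =>
      isEffectivelyOpen_of_modulusOfOpenness hX hf (exists_modulusOfOpenness_of_Moo h.1 h.2)⟩,
    fun f hf => ⟨exists_modulusOfOpenness_of_isEffectivelyOpen hX hf,
      isEffectivelyOpen_of_modulusOfOpenness hX hf⟩⟩
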